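/- Let $k$ be a field and $Q=(Q_0,Q_1,s,t)$ a finite quiver. Paths are written $p=\alpha_1\cdots\alpha_n$ with $t(\alpha_{i-1})=s(\alpha_i)$, and $e_i$ is the trivial path at the vertex $i$. *The path coalgebra* $C=kQ^c$ has the set of all paths of $Q$ as a $k$-basis, comultiplication $\Delta(p)=\sum_{p=p_1p_2}p_1\otimes p_2$ (over all ways to write $p$ as a concatenation of two paths, trivial ones allowed), and counit $\varepsilon(e_i)=1$, $\varepsilon(p)=0$ for nontrivial $p$. A subcoalgebra $D\subseteq C$ is *large* if it contains all trivial paths and all arrows. The dual algebra of a coalgebra $D$ is $D^*=\operatorname{Hom}_k(D,k)$ with the convolution product $(f*g)(d)=\sum f(d_{(1)})g(d_{(2)})$ and unit $\varepsilon$. *The complete path algebra* $\widehat{kQ^a}$ is the space of all families $(a_p)_p$ of scalars indexed by the paths of $Q$, with product $(ab)_p=\sum_{p=p_1p_2}a_{p_1}b_{p_2}$; it is paired with $C$ by $(a,\sum_p c_p p)=\sum_p a_pc_p$. $\operatorname{Aut}$ denotes the group of $k$-coalgebra, respectively $k$-algebra, automorphisms. *Trans-data.* For $g,h\in C$ put $P_{g,h}=\{x\in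 C\mid \Delta(x)=g\otimes x+x\otimes h\}$. A trans-datum of $Q$ is a pair $\mu=(\mu_0,(\mu_p)_p)$ of a coalgebra homomorphism $\mu_0\colon kQ_0\to kQ_0$ and, for every nontrivial path $p$, an element $\mu_p\in P_{\mu_0(e_{s(p)}),\mu_0(e_{t(p)})}$. Let $\Omega(Q)$ be the set of all trans-data. Let $Q^\tau$ be the quiver obtained from $Q$ by adding one arrow $e_{i,j}\colon i\to j$ for each pair of vertices $i\ne j$; identify $P_{e_i,e_j}$ with the span of the arrows $i\to j$ of $Q^\tau$ by letting $e_{i,j}$ correspond to $e_i-e_j$. Let $F$ be the linear map from the span of the paths of $Q^\tau$ to $kQ$ given as follows, where $p$ denotes a nontrivial path of $Q$ and $e=e_{i_1,i_2}\cdots e_{i_n,i_{n+1}}$ ($n\ge1$) a nontrivial path consisting of new arrows: $F$ is the identity on the paths of $Q$, $F(e)=e_{i_1}-e_{i_2}$, $F(pe)=p$, $F(e_{i,s(p)}\,p)=F(e_{i,s(p)}\,p\,e)=-p$, and $F$ is $0$ on all other paths. To $\mu\in\Omega(Q)$ one associates the linear map $f_\mu\colon kQ\to kQ$ with $f_\mu(e_i)=\mu_0(e_i)$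 and $$f_\mu(p)=\sum_{p=p_1\cdots p_r}F(\mu_{p_1}\Box\cdots\Box\mu_{p_r})$$ for nontrivial $p$, the sum being over all decompositions of $p$ into nontrivial paths; here $\mu_{p_1}\Box\cdots\Box\mu_{p_r}$ is the (concatenation) product of the $\mu_{p_i}$, viewed as linear combinations of arrows of $Q^\tau$. Let $\mathbb 1\in\Omega(Q)$ be given by $\mathbb 1_0=\mathrm{id}$, $\mathbb 1_\alpha=\alpha$ for arrows $\alpha$, and $\mathbb 1_p=0$ for paths $p$ of length at least $2$. The composition $\nu\circ\mu$ of trans-data is the trans-datum determined by $f_{\nu\circ\mu}=f_\nu f_\mu$, and $\Omega^*(Q)$ is the group of invertible elements of $(\Omega(Q),\circ,\mathbb 1)$. **Corollary.** 1. Let $D$ be a large subcoalgebra of $kQ^c$ and $B=D^*$ its dual algebra. Then $\sigma\mapsto\sigma^*$, $\sigma^*(f)=f\circ\sigma$, is an anti-isomorphism of groups $\operatorname{Aut}(D)\to\operatorname{Aut}(B)$, i.e. an isomorphism $\operatorname{Aut}(D)\cong\operatorname{Aut}(B)^{\mathrm{op}}$. 2. In particular $\operatorname{Aut}(\widehat{kQ^a})\cong\operatorname{Aut}(kQ^c)\cong\Omega^*(Q)$.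 More precisely, there is an isomorphism of groups $\Psi\colon\operatorname{Aut}(kQ^c)\to\operatorname{Aut}(\widehat{kQ^a})$ with $(\Psi(\sigma)a,c)=(a,\sigma^{-1}(c))$ for all $a\in\widehat{kQ^a}$, $c\in kQ^c$; for all $\mu,\nu\in\Omega(Q)$ there is exactly one $\nu\circ\mu\in\Omega(Q)$ with $f_{\nu\circ\mu}=f_\nu f_\mu$, and this makes $\Omega(Q)$ a monoid with identity $\mathbb 1$; and there is an isomorphism of groups $\operatorname{Aut}(kQ^c)\to\Omega^*(Q)$ sending $\sigma$ to the trans-datum $\mu$ with $f_\mu=\sigma$. -/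

import Mathlib

open scoped TensorProduct

namespace QuiverCoalgebra

universe w u v u₁ v₁ u₂ v₂

/-! ### Automorphism groups of coalgebras, subcoalgebras -/

section Coalgebras

variable {k : Type w} [Field k] {C : Type u} [AddCommGroup C] [Module k C] [Coalgebra k C]

/-- The group `Aut(C)` of coalgebra automorphisms of `C`, under composition `(σ * τ) x = σ (τ x)`. -/
instance : Group (C ≃ₗc[k] C) where
  mul σ τ := τ.trans σ
  one := CoalgEquiv.refl k C
  inv σ := σ.symm
  mul_assoc _ _ _ := rfl
  one_mul _ := rfl
  mul_one _ := rfl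
  inv_mul_cancel σ := CoalgEquiv.ext fun x => σ.symm_apply_apply x

variable (k C) in
/-- A subcoalgebra of `C`: a subspace `D` with `Δ(D) ⊆ D ⊗ D` (inside `C ⊗ C`). -/
structure Subcoalgebra extends Submodule k C where
  comul_mem : ∀ x ∈ toSubmodule, Coalgebra.comul (R := k) x ∈
    LinearMap.range (TensorProduct.map toSubmodule.subtype toSubmodule.subtype)

namespace Subcoalgebra

lemma map_injective {M N M' N' : Type*} [AddCommGroup M] [Module k M] [AddCommGroup N] [Module k N]
    [AddCommGroup M'] [Module k M'] [AddCommGroup N'] [Module k N']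
    (f : M →ₗ[k] M') (g : N →ₗ[k] N') (hf : Function.Injective f) (hg : Function.Injective g) :
    Function.Injective (TensorProduct.map f g) := by
  rw [← LinearMap.lTensor_comp_rTensor]
  exact (Module.Flat.lTensor_preserves_injective_linearMap g hg).comp
    (Module.Flat.rTensor_preserves_injective_linearMap f hf)

variable (D : Subcoalgebra k C)

lemma incl_injective : Function.Injective
    (TensorProduct.map D.toSubmodule.subtype D.toSubmodule.subtype) :=
  map_injective _ _ D.toSubmodule.injective_subtype D.toSubmodule.injective_subtype

/-- The comultiplication of a subcoalgebra: the restriction of the ambient one. -/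
noncomputable def comul : D.toSubmodule →ₗ[k] D.toSubmodule ⊗[k] D.toSubmodule :=
  (LinearEquiv.ofInjective _ D.incl_injective).symm.toLinearMap ∘ₗ
    (Coalgebra.comul ∘ₗ D.toSubmodule.subtype).codRestrict _ fun x => D.comul_mem x x.2

lemma map_comul (x : D.toSubmodule) :
    TensorProduct.map D.toSubmodule.subtype D.toSubmodule.subtype (D.comul x) =
      Coalgebra.comul (R := k) (x : C) := by
  have h := (LinearEquiv.ofInjective _ D.incl_injective).apply_symm_apply
    ((Coalgebra.comul ∘ₗ D.toSubmodule.subtype).codRestrict _ (fun x => D.comul_mem x x.2) x)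
  exact congrArg Subtype.val h

lemma map_comp_comul :
    TensorProduct.map D.toSubmodule.subtype D.toSubmodule.subtype ∘ₗ D.comul =
      Coalgebra.comul ∘ₗ D.toSubmodule.subtype :=
  LinearMap.ext D.map_comul

/-- A subcoalgebra is a coalgebra, with the restricted comultiplication and counit. -/
noncomputable instance : Coalgebra k D.toSubmodule where
  comul := D.comul
  counit := Coalgebra.counit ∘ₗ D.toSubmodule.subtype
  coassoc := by
    have hinj : Function.Injective (TensorProduct.map D.toSubmodule.subtype
        (TensorProduct.map D.toSubmodule.subtype D.toSubmodule.subtype)) :=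
      map_injective _ _ D.toSubmodule.injective_subtype D.incl_injective
    have h1 : TensorProduct.map D.toSubmodule.subtype
          (TensorProduct.map D.toSubmodule.subtype D.toSubmodule.subtype) ∘ₗ
          (TensorProduct.assoc k _ _ _).toLinearMap ∘ₗ D.comul.rTensor D.toSubmodule =
        (TensorProduct.assoc k C C C).toLinearMap ∘ₗ (Coalgebra.comul (R := k)).rTensor C ∘ₗ
          TensorProduct.map D.toSubmodule.subtype D.toSubmodule.subtype := by
      rw [← LinearMap.comp_assoc, TensorProduct.map_map_comp_assoc_eq, LinearMap.comp_assoc,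
        LinearMap.map_comp_rTensor, LinearMap.rTensor_comp_map, D.map_comp_comul]
    have h2 : TensorProduct.map D.toSubmodule.subtype
          (TensorProduct.map D.toSubmodule.subtype D.toSubmodule.subtype) ∘ₗ
          D.comul.lTensor D.toSubmodule =
        (Coalgebra.comul (R := k)).lTensor C ∘ₗ
          TensorProduct.map D.toSubmodule.subtype D.toSubmodule.subtype := by
      rw [LinearMap.map_comp_lTensor, LinearMap.lTensor_comp_map, D.map_comp_comul]
    ext x
    apply hinj
    have e1 := LinearMap.congr_fun h1 (D.comul x)
    have e2 := LinearMap.congr_fun h2 (D.comul x)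
    simp only [LinearMap.comp_apply, D.map_comul] at e1 e2 ⊢
    rw [e1, e2]
    exact Coalgebra.coassoc_apply (R := k) (x : C)
  rTensor_counit_comp_comul := by
    have hinj : Function.Injective (D.toSubmodule.subtype.lTensor k) :=
      Module.Flat.lTensor_preserves_injective_linearMap _ D.toSubmodule.injective_subtype
    have h : D.toSubmodule.subtype.lTensor k ∘ₗ
          (Coalgebra.counit (R := k) ∘ₗ D.toSubmodule.subtype).rTensor D.toSubmodule =
        (Coalgebra.counit (R := k)).rTensor C ∘ₗ
          TensorProduct.map D.toSubmodule.subtype D.toSubmodule.subtype := by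
      rw [LinearMap.lTensor_comp_rTensor, LinearMap.rTensor_comp_map]
    ext x
    apply hinj
    have e := LinearMap.congr_fun h (D.comul x)
    simp only [LinearMap.comp_apply, D.map_comul] at e ⊢
    rw [e]
    simp
  lTensor_counit_comp_comul := by
    have hinj : Function.Injective (D.toSubmodule.subtype.rTensor k) :=
      Module.Flat.rTensor_preserves_injective_linearMap _ D.toSubmodule.injective_subtype
    have h : D.toSubmodule.subtype.rTensor k ∘ₗ
          (Coalgebra.counit (R := k) ∘ₗ D.toSubmodule.subtype).lTensor D.toSubmodule =
        (Coalgebra.counit (R := k)).lTensor C ∘ₗ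
          TensorProduct.map D.toSubmodule.subtype D.toSubmodule.subtype := by
      rw [LinearMap.rTensor_comp_lTensor, LinearMap.lTensor_comp_map]
    ext x
    apply hinj
    have e := LinearMap.congr_fun h (D.comul x)
    simp only [LinearMap.comp_apply, D.map_comul] at e ⊢
    rw [e]
    simp

end Subcoalgebra

variable (k) in
/-- The primitive elements `P_{g,h} = {x | Δ(x) = g ⊗ x + x ⊗ h}`. -/
def primitiveElements (g h : C) : Submodule k C where
  carrier := {x | Coalgebra.comul (R := k) x = g ⊗ₜ[k] x + x ⊗ₜ[k] h}
  zero_mem' := by simp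
  add_mem' {x y} hx hy := by
    simp only [Set.mem_ofPred_eq, map_add, TensorProduct.tmul_add, TensorProduct.add_tmul] at *
    rw [hx, hy]; abel
  smul_mem' c x hx := by
    simp only [Set.mem_ofPred_eq, map_smul, TensorProduct.tmul_smul, TensorProduct.smul_tmul'] at *
    rw [hx, smul_add]; rfl

end Coalgebras

/-! ### Paths and their splittings -/

open Quiver

/-- The set of all paths (trivial ones included) of a quiver. -/
@[ext] structure AnyPath (V : Type u) [Quiver.{v} V] where
  src : V
  tgt : V
  path : Path src tgt

section Paths

variable {V : Type u} [Quiver.{v} V]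

/-- A path regarded as an element of the set of all paths. -/
abbrev mkPath {a b : V} (p : Path a b) : AnyPath V := ⟨a, b, p⟩

/-- The list of all ways `p = p₁ p₂` of splitting a path (trivial pieces allowed). -/
def splits {a : V} : {b : V} → Path a b → List (Σ c : V, Path a c × Path c b)
  | _, .nil => [⟨a, .nil, .nil⟩]
  | _, .cons p α => (splits p).map (fun s => ⟨s.1, s.2.1, s.2.2.cons α⟩) ++ [⟨_, p.cons α, .nil⟩]

lemma mem_splits {a b : V} (p : Path a b) (s : Σ c : V, Path a c × Path c b) :
    s ∈ splits p ↔ s.2.1.comp s.2.2 = p := by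
  induction p with
  | nil =>
    obtain ⟨c, x, y⟩ := s
    cases y with
    | nil => simp [splits]
    | cons y β =>
      constructor
      · intro h
        have h := List.mem_singleton.1 h
        obtain rfl : c = _ := congrArg Sigma.fst h
        simp at h
      · intro h
        simp at h
  | cons p α ih =>
    obtain ⟨c, x, y⟩ := s
    simp only [splits, List.mem_append, List.mem_map, List.mem_singleton]
    constructor
    · rintro (⟨⟨d, x', y'⟩, ht, h⟩ | h)
      · rw [ih] at ht
        cases h
        simpa using congrArg (fun q => Path.cons q α) ht
      · cases h; rfl
    · intro h
      cases y with
      | nil => right; cases h; rfl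
      | cons y β =>
        left
        simp only [Path.comp_cons] at h
        cases h
        exact ⟨⟨c, x, y⟩, (ih _).2 rfl, rfl⟩

lemma nodup_splits {a b : V} (p : Path a b) : (splits p).Nodup := by
  induction p with
  | nil => simp [splits]
  | cons p α ih =>
    rw [splits, List.nodup_append]
    refine ⟨ih.map ?_, by simp, ?_⟩
    · rintro ⟨c, x, y⟩ ⟨d, x', y'⟩ h
      cases h; rfl
    · rintro s hs t ht rfl
      rw [List.mem_singleton] at ht
      subst ht
      obtain ⟨⟨c, x, y⟩, -, h⟩ := List.mem_map.1 hs
      have h1 : c = _ := congrArg Sigma.fst h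
      subst h1
      simp at h

lemma splits_assoc {M : Type*} [AddCommMonoid M] {a b : V} (p : Path a b)
    (h : ∀ c d : V, Path a c → Path c d → Path d b → M) :
    ((splits p).map fun s => ((splits s.2.1).map fun t => h t.1 s.1 t.2.1 t.2.2 s.2.2).sum).sum =
    ((splits p).map fun s => ((splits s.2.2).map fun t => h s.1 t.1 s.2.1 t.2.1 t.2.2).sum).sum := by
  induction p with
  | nil => simp [splits]
  | cons p α ih =>
    have := ih fun c d x y z => h c d x y (z.cons α)
    simp only [splits, List.map_append, List.map_map, List.sum_append, Function.comp_def,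
      List.map_cons, List.map_nil, List.sum_cons, List.sum_nil, add_zero, List.sum_map_add]
    rw [this, add_assoc]

/-- The list of all ways of splitting a path into two paths. -/
def AnyPath.splits (p : AnyPath V) : List (AnyPath V × AnyPath V) :=
  (QuiverCoalgebra.splits p.path).map fun s => (mkPath s.2.1, mkPath s.2.2)

lemma AnyPath.splits_assoc {M : Type*} [AddCommMonoid M] (p : AnyPath V)
    (h : AnyPath V → AnyPath V → AnyPath V → M) :
    (p.splits.map fun s => (s.1.splits.map fun t => h t.1 t.2 s.2).sum).sum =
    (p.splits.map fun s => (s.2.splits.map fun t => h s.1 t.1 t.2).sum).sum := by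
  simpa [AnyPath.splits, List.map_map, Function.comp_def] using
    QuiverCoalgebra.splits_assoc p.path fun c d x y z => h (mkPath x) (mkPath y) (mkPath z)

lemma AnyPath.splits_left {M : Type*} [AddCommMonoid M] (p : AnyPath V) (h : AnyPath V → M) :
    (p.splits.map fun s => if s.1.path.length = 0 then h s.2 else 0).sum = h p := by
  have key : ∀ {a b : V} (p : Path a b) (h : ∀ c : V, Path c b → M),
      ((QuiverCoalgebra.splits p).map fun s =>
        if s.2.1.length = 0 then h s.1 s.2.2 else 0).sum = h a p := by
    intro a b p
    induction p with
    | nil => intro h; simp [QuiverCoalgebra.splits]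
    | cons p α ih =>
      intro h
      simpa [QuiverCoalgebra.splits, List.map_map, Function.comp_def] using
        ih fun c q => h c (q.cons α)
  simpa [AnyPath.splits, List.map_map, Function.comp_def] using
    key p.path fun c q => h (mkPath q)

lemma AnyPath.splits_right {M : Type*} [AddCommMonoid M] (p : AnyPath V) (h : AnyPath V → M) :
    (p.splits.map fun s => if s.2.path.length = 0 then h s.1 else 0).sum = h p := by
  obtain ⟨a, b, p⟩ := p
  simp only [AnyPath.splits, List.map_map, Function.comp_def]
  cases p with
  | nil => simp [QuiverCoalgebra.splits]
  | cons p α => simp [QuiverCoalgebra.splits, List.map_map, Function.comp_def]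

end Paths

/-! ### The path coalgebra and the complete path algebra -/

section PathCoalgebra

variable (k : Type w) [Field k] (V : Type u) [Quiver.{v} V]

/-- The underlying space `kQ` of the path coalgebra: it has the set of all paths as basis. -/
def PathCoalgebra : Type _ := AnyPath V →₀ k

noncomputable instance : AddCommGroup (PathCoalgebra k V) :=
  inferInstanceAs (AddCommGroup (AnyPath V →₀ k))

noncomputable instance : Module k (PathCoalgebra k V) :=
  inferInstanceAs (Module k (AnyPath V →₀ k))

namespace PathCoalgebra

variable {V}

/-- The basis element of the path coalgebra given by a path. -/
noncomputable def ofPath (p : AnyPath V) : PathCoalgebra k V := Finsupp.single p (1 : k)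

variable {k} in
/-- The coefficient of a path in an element of the path coalgebra. -/
def coeff (x : PathCoalgebra k V) (p : AnyPath V) : k := (show AnyPath V →₀ k from x) p

/-- The linear map out of `kQ` with prescribed values on paths. -/
noncomputable def lift {M : Type*} [AddCommGroup M] [Module k M] (f : AnyPath V → M) :
    PathCoalgebra k V →ₗ[k] M :=
  Finsupp.linearCombination k f

@[simp] lemma lift_ofPath {M : Type*} [AddCommGroup M] [Module k M] (f : AnyPath V → M)
    (p : AnyPath V) : lift k f (ofPath k p) = f p :=
  (Finsupp.linearCombination_single k 1 p).trans (one_smul k _)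

variable {k} in
lemma hom_ext {M : Type*} [AddCommGroup M] [Module k M] {f g : PathCoalgebra k V →ₗ[k] M}
    (h : ∀ p, f (ofPath k p) = g (ofPath k p)) : f = g :=
  Finsupp.lhom_ext' fun p => LinearMap.ext_ring (h p)

end PathCoalgebra

open PathCoalgebra

lemma sum_tmul_list {M N : Type*} [AddCommGroup M] [Module k M] [AddCommGroup N] [Module k N]
    (l : List M) (n : N) : l.sum ⊗ₜ[k] n = (l.map fun m => m ⊗ₜ[k] n).sum :=
  map_list_sum ((TensorProduct.mk k M N).flip n) l

lemma tmul_sum_list {M N : Type*} [AddCommGroup M] [Module k M] [AddCommGroup N] [Module k N]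
    (m : M) (l : List N) : m ⊗ₜ[k] l.sum = (l.map fun n => m ⊗ₜ[k] n).sum :=
  map_list_sum (TensorProduct.mk k M N m) l

/-- The path coalgebra: `Δ(p) = ∑_{p = p₁p₂} p₁ ⊗ p₂`, and `ε(p)` is `1` if `p` is trivial and
`0` otherwise. -/
noncomputable instance : Coalgebra k (PathCoalgebra k V) where
  comul := lift k fun p => (p.splits.map fun s => ofPath k s.1 ⊗ₜ[k] ofPath k s.2).sum
  counit := lift k fun p => if p.path.length = 0 then 1 else 0
  coassoc := by
    refine hom_ext fun p => ?_
    simpa [map_list_sum, List.map_map, Function.comp_def, sum_tmul_list, tmul_sum_list] using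
      p.splits_assoc fun x y z => ofPath k x ⊗ₜ[k] (ofPath k y ⊗ₜ[k] ofPath k z)
  rTensor_counit_comp_comul := by
    refine hom_ext fun p => ?_
    simpa [map_list_sum, List.map_map, Function.comp_def, TensorProduct.ite_tmul] using
      p.splits_left fun x => (1 : k) ⊗ₜ[k] ofPath k x
  lTensor_counit_comp_comul := by
    refine hom_ext fun p => ?_
    simpa [map_list_sum, List.map_map, Function.comp_def, TensorProduct.tmul_ite] using
      p.splits_right fun x => ofPath k x ⊗ₜ[k] (1 : k)

lemma comul_ofPath (p : AnyPath V) : Coalgebra.comul (R := k) (ofPath k p) =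
    (p.splits.map fun s => ofPath k s.1 ⊗ₜ[k] ofPath k s.2).sum :=
  lift_ofPath k _ p

lemma counit_ofPath (p : AnyPath V) : Coalgebra.counit (R := k) (ofPath k p) =
    if p.path.length = 0 then (1 : k) else 0 :=
  lift_ofPath k _ p

/-- The complete path algebra: families `(a_p)` of scalars indexed by all paths. -/
def CompletePathAlgebra : Type _ := AnyPath V → k

namespace CompletePathAlgebra

instance : AddCommGroup (CompletePathAlgebra k V) := inferInstanceAs (AddCommGroup (AnyPath V → k))

instance : Module k (CompletePathAlgebra k V) := inferInstanceAs (Module k (AnyPath V → k))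

variable {k V}

@[ext] lemma ext {a b : CompletePathAlgebra k V} (h : ∀ p, a p = b p) : a = b := funext h

lemma add_apply (a b : CompletePathAlgebra k V) (p : AnyPath V) : (a + b) p = a p + b p := rfl

lemma zero_apply (p : AnyPath V) : (0 : CompletePathAlgebra k V) p = 0 := rfl

lemma smul_apply (c : k) (a : CompletePathAlgebra k V) (p : AnyPath V) : (c • a) p = c * a p := rfl

/-- The product `(a b)_p = ∑_{p = p₁p₂} a_{p₁} b_{p₂}`. -/
instance : Mul (CompletePathAlgebra k V) :=
  ⟨fun a b p => (p.splits.map fun s => a s.1 * b s.2).sum⟩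

/-- The unit `∑ e_i`. -/
instance : One (CompletePathAlgebra k V) := ⟨fun p => if p.path.length = 0 then 1 else 0⟩

lemma mul_apply (a b : CompletePathAlgebra k V) (p : AnyPath V) :
    (a * b) p = (p.splits.map fun s => a s.1 * b s.2).sum := rfl

lemma one_apply (p : AnyPath V) :
    (1 : CompletePathAlgebra k V) p = if p.path.length = 0 then 1 else 0 := rfl

instance : Ring (CompletePathAlgebra k V) :=
  { (inferInstance : AddCommGroup (CompletePathAlgebra k V)) with
    left_distrib := fun a b c => by
      ext p; simp [mul_apply, add_apply, mul_add, List.sum_map_add]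
    right_distrib := fun a b c => by
      ext p; simp [mul_apply, add_apply, add_mul, List.sum_map_add]
    zero_mul := fun a => by ext p; simp [mul_apply, zero_apply]
    mul_zero := fun a => by ext p; simp [mul_apply, zero_apply]
    mul_assoc := fun a b c => by
      ext p
      simp only [mul_apply, ← List.sum_map_mul_right, ← List.sum_map_mul_left]
      simpa only [mul_assoc] using p.splits_assoc fun x y z => a x * (b y * c z)
    one_mul := fun a => by
      ext p
      simpa [mul_apply, one_apply, ite_mul] using p.splits_left a
    mul_one := fun a => by
      ext p
      simpa [mul_apply, one_apply, mul_ite] using p.splits_right a }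

noncomputable instance : Algebra k (CompletePathAlgebra k V) :=
  Algebra.ofModule
    (fun c a b => by
      ext p; simp [mul_apply, smul_apply, ← List.sum_map_mul_left, mul_assoc])
    (fun c a b => by
      ext p; simp [mul_apply, smul_apply, ← List.sum_map_mul_left, mul_left_comm])

end CompletePathAlgebra

/-- The pairing `(a, c) = ∑_p a_p c_p` between the complete path algebra and the path coalgebra. -/
noncomputable def pairing (a : CompletePathAlgebra k V) : PathCoalgebra k V →ₗ[k] k :=
  PathCoalgebra.lift k a

variable {k V} in
/-- A subcoalgebra of the path coalgebra is large if it contains all trivial paths and arrows. -/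
def IsLarge (D : Subcoalgebra k (PathCoalgebra k V)) : Prop :=
  ∀ p : AnyPath V, p.path.length ≤ 1 → ofPath k p ∈ D.toSubmodule

end PathCoalgebra

/-! ### The augmented quiver and the coalgebra map `F` -/

section Augmented

variable {V : Type u} [Quiver.{v} V]

/-- The arrows from `a` to `b` in the augmented quiver: those of `Q`, and one new arrow `e_{a,b}`
if `a ≠ b`. -/
inductive AugArrow (a b : V) : Type v
  | old (α : a ⟶ b) : AugArrow a b
  | new (h : a ≠ b) : AugArrow a b

variable (V) in
/-- The vertices of the augmented quiver of `Q`, which are those of `Q`. -/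
def Augmented : Type u := V

instance : Quiver.{v} (Augmented V) := ⟨fun a b => AugArrow (V := V) a b⟩

/-- The paths of the augmented quiver. -/
abbrev AugPath (a b : V) := Path (V := Augmented V) a b

/-- If no new arrow occurs in `q`, then `q` itself, as a path of the original quiver. -/
def oldPart {a : V} : {b : V} → AugPath a b → Option (Path a b)
  | _, .nil => some .nil
  | _, .cons q (.old α) => (oldPart q).map fun p => p.cons α
  | _, .cons _ (.new _) => none

/-- If `q = e_{a,c} p` for a new arrow `e_{a,c}` and a (possibly trivial) path `p` of the original
quiver, then the pair `(c, p)`. -/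
def newOldPart {a : V} : {b : V} → AugPath a b → Option (Σ c : V, Path c b)
  | _, .nil => none
  | _, .cons q (.old α) => (newOldPart q).map fun s => ⟨s.1, s.2.cons α⟩
  | b, .cons q (.new _) => if q.length = 0 then some ⟨b, .nil⟩ else none

variable (k : Type w) [Field k]

/-- The value on a path of the augmented quiver of the linear map `F : k(Q^τ)^c → kQ^c` with
`F(p) = p` for `p` a path of `Q`, `F(e) = e_{i₁} - e_{i₂}` for
`e = e_{i₁,i₂} e_{i₂,i₃} ⋯ e_{iₙ,iₙ₊₁}` with `n ≥ 1`, `F(p e) = p`, `F(e_{s,s(p)} p) = -p` and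
`F(e_{s,s(p)} p e) = -p` for `p` a nontrivial path of `Q` and `e` as before, and `F(q) = 0` for all
other paths `q`.

The recursion is on the last arrow. If it is new, then it may be deleted without
changing the value, unless it is the only arrow. If it is an arrow `α` of `Q`, then the value is
nonzero only on the paths `p α` and `e_{s,s(p)} p α` with `p` a (possibly trivial) path of `Q`. -/
noncomputable def augValue {a : V} : {b : V} → AugPath a b → PathCoalgebra k V
  | _, .nil => PathCoalgebra.ofPath k (mkPath (.nil : Path a a))
  | b, .cons q (.new _) =>
    if q.length = 0 then
      PathCoalgebra.ofPath k (mkPath (.nil : Path a a)) -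
        PathCoalgebra.ofPath k (mkPath (.nil : Path b b))
    else augValue q
  | _, .cons q (.old α) =>
    match oldPart q, newOldPart q with
    | some p, _ => PathCoalgebra.ofPath k (mkPath (p.cons α))
    | none, some s => -PathCoalgebra.ofPath k (mkPath (s.2.cons α))
    | none, none => 0

end Augmented

/-! ### Decompositions of a path into nontrivial pieces -/

section Decompositions

variable {V : Type u} [Quiver.{v} V]

variable (V) in
/-- The quiver with the vertices of `Q` whose arrows are the nontrivial paths of `Q`. -/
def Pieces : Type u := V

instance : Quiver (Pieces V) := ⟨fun a b : V => {p : Path a b // 0 < p.length}⟩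

/-- A sequence `(p₁, …, pᵣ)` of composable nontrivial paths, from `a` to `b`. -/
abbrev Decomposition (a b : V) := Path (V := Pieces V) a b

/-- The composite path `p₁ ⋯ pᵣ`. -/
def Decomposition.comp {a : V} : {b : V} → Decomposition a b → Path a b
  | _, .nil => .nil
  | _, .cons d q => (Decomposition.comp d).comp q.1

/-- Append the arrow `α` to the last piece of a decomposition, if there is one. -/
def Decomposition.extendLast {a b c : V} (α : b ⟶ c) : Decomposition a b → List (Decomposition a c)
  | .nil => []
  | .cons d q => [.cons d ⟨q.1.cons α, Nat.succ_pos _⟩]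

/-- The list of all decompositions `p = p₁ ⋯ pᵣ` into nontrivial paths. -/
def decompositions {a : V} : {b : V} → Path a b → List (Decomposition a b)
  | _, .nil => [.nil]
  | _, .cons p α => (decompositions p).flatMap fun d =>
      Path.cons d ⟨α.toPath, Nat.one_pos⟩ :: Decomposition.extendLast α d

lemma mem_decompositions {a b : V} (p : Path a b) (d : Decomposition a b) :
    d ∈ decompositions p ↔ d.comp = p := by
  induction p with
  | nil =>
    rw [decompositions, List.mem_singleton]
    constructor
    · rintro rfl; rfl
    · intro h
      cases d with
      | nil => rfl
      | cons d q =>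
        have := congrArg Path.length h
        have hq := q.2
        simp only [Decomposition.comp, Path.length_comp, Path.length_nil] at this
        omega
  | cons p α ih =>
    simp only [decompositions, List.mem_flatMap, List.mem_cons]
    constructor
    · rintro ⟨d', hd', rfl | h⟩
      · change (Decomposition.comp d').comp α.toPath = _
        rw [(ih d').1 hd']; rfl
      · cases d' with
        | nil => simp [Decomposition.extendLast] at h
        | cons d' q =>
          obtain rfl := List.mem_singleton.1 h
          rw [← (ih _).1 hd']; rfl
    · intro h
      cases d with
      | nil => simp [Decomposition.comp] at h
      | cons d' q =>
        obtain ⟨q, hq⟩ := q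
        cases q with
        | nil => simp at hq
        | cons q β =>
          change ((Decomposition.comp d').comp q).cons β = _ at h
          cases h
          by_cases hq' : 0 < q.length
          · exact ⟨.cons d' ⟨q, hq'⟩, (ih _).2 rfl, Or.inr (List.mem_singleton.2 rfl)⟩
          · cases q with
            | nil => exact ⟨d', (ih _).2 rfl, Or.inl rfl⟩
            | cons q γ => simp at hq'

lemma nodup_decompositions {a b : V} (p : Path a b) : (decompositions p).Nodup := by
  induction p with
  | nil => simp [decompositions]
  | @cons b c p α ih =>
    rw [decompositions, List.nodup_flatMap]
    have key : ∀ d d' : Decomposition a b, ∀ e : Decomposition a c,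
        e ∈ (Path.cons d ⟨α.toPath, Nat.one_pos⟩ :: Decomposition.extendLast α d) →
        e ∈ (Path.cons d' ⟨α.toPath, Nat.one_pos⟩ :: Decomposition.extendLast α d') → d = d' := by
      intro d d' e h h'
      rcases List.mem_cons.1 h with rfl | h <;> rcases List.mem_cons.1 h' with h' | h'
      · cases h'; rfl
      · cases d' with
        | nil => cases h'
        | cons d' q =>
          obtain ⟨q, hq⟩ := q
          have h' := List.mem_singleton.1 h'
          cases q with
          | nil => simp at hq
          | cons q β => cases h'
      · cases d with
        | nil => cases h
        | cons d q =>
          obtain ⟨q, hq⟩ := q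
          have h := List.mem_singleton.1 h
          subst h
          cases q with
          | nil => simp at hq
          | cons q β => cases h'
      · cases d with
        | nil => cases h
        | cons d q =>
          cases d' with
          | nil => cases h'
          | cons d' q' =>
            have h := List.mem_singleton.1 h
            have h' := List.mem_singleton.1 h'
            obtain ⟨q, hq⟩ := q
            obtain ⟨q', hq'⟩ := q'
            subst h
            cases h'; rfl
    constructor
    · rintro d -
      cases d with
      | nil => simp [Decomposition.extendLast]
      | cons d q =>
        refine List.nodup_cons.2 ⟨fun h => ?_, List.nodup_singleton _⟩
        have h : Path.length (V := Pieces V) d + 1 + 1 = Path.length (V := Pieces V) d + 1 :=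
          congrArg Path.length (List.mem_singleton.1 h)
        omega
    · exact ih.imp fun hne => List.disjoint_left.2 fun e h h' => hne (key _ _ e h h')

end Decompositions

/-! ### Trans-data -/

section TransData

variable (k : Type w) [Field k]

/-- The inclusion `kQ₀ → kQ`. -/
noncomputable def vertexIncl (V : Type u) [Quiver.{v} V] : (V →₀ k) →ₗ[k] PathCoalgebra k V :=
  Finsupp.linearCombination k fun i => PathCoalgebra.ofPath k (mkPath (.nil : Path i i))

/-- A trans-datum from the quiver `V` to the quiver `W`: a coalgebra homomorphism `μ₀ : kV₀ → kW₀`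
(where `kV₀` is the coalgebra with a basis of group-like elements indexed by the vertices) and, for
each nontrivial path `p`, an element `μ_p ∈ P_{μ₀(e_{s(p)}), μ₀(e_{t(p)})}` of the path
coalgebra of `W`. -/
@[ext] structure TransDatum (V : Type u₁) [Quiver.{v₁} V] (W : Type u₂) [Quiver.{v₂} W] where
  zero : (V →₀ k) →ₗc[k] (W →₀ k)
  plus : {p : AnyPath V // 0 < p.path.length} → PathCoalgebra k W
  plus_mem : ∀ p, plus p ∈ primitiveElements k
    (vertexIncl k W (zero (Finsupp.single p.1.src 1)))
    (vertexIncl k W (zero (Finsupp.single p.1.tgt 1)))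

variable {k}

/-- The group-like elements of `kX` are the basis elements. -/
lemma exists_eq_single {X : Type*} {g : X →₀ k} (hg : IsGroupLikeElem k g) :
    ∃ x, g = Finsupp.single x 1 := by
  have hX : ∀ x : X, IsGroupLikeElem k (Finsupp.single x (1 : k)) := fun x =>
    ⟨by simp, by simp⟩
  by_contra! h
  have h1 : LinearIndepOn k id (insert g (Set.range fun x : X => Finsupp.single x (1 : k))) :=
    linearIndepOn_isGroupLikeElem.mono <| by
      rintro _ (rfl | ⟨x, rfl⟩)
      exacts [hg, hX x]
  have h2 := h1.notMem_span_of_insert fun ⟨x, hx⟩ => h x hx.symm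
  refine h2 ?_
  rw [Set.image_id]
  have : g = g.sum fun x c => c • Finsupp.single x (1 : k) := by simp
  rw [this]
  exact Submodule.sum_mem _ fun x _ => Submodule.smul_mem _ _ (Submodule.subset_span ⟨x, rfl⟩)

lemma exists_vertex {X Y : Type*} (f : (X →₀ k) →ₗc[k] (Y →₀ k)) (x : X) :
    ∃ y : Y, f (Finsupp.single x 1) = Finsupp.single y 1 :=
  exists_eq_single (IsGroupLikeElem.map f ⟨by simp, by simp⟩)

section Primitive

variable {W : Type u₂} [Quiver.{v₂} W]

lemma toPath_injective (s t : W) :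
    Function.Injective fun α : s ⟶ t => (mkPath α.toPath : AnyPath W) := by
  intro α β h
  simpa [Quiver.Hom.toPath] using h

/-- The identification of `P_{e_s, e_t}` with the space spanned by the arrows from `s` to `t` of the
augmented quiver: an element `c (e_s - e_t) + ∑ c_α α` corresponds to `c e_{s,t} + ∑ c_α α`. -/
noncomputable def toAugArrows (s t : W) (x : PathCoalgebra k W) : AugArrow s t →₀ k :=
  Finsupp.mapDomain AugArrow.old
    (Finsupp.comapDomain (fun α : s ⟶ t => (mkPath α.toPath : AnyPath W)) x
      (toPath_injective s t).injOn) +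
  open Classical in
    if h : s = t then 0 else Finsupp.single (.new h) (x.coeff (mkPath (.nil : Path s s)))

end Primitive

namespace TransDatum

variable {V : Type u₁} [Quiver.{v₁} V] {W : Type u₂} [Quiver.{v₂} W] (μ : TransDatum k V W)

/-- The vertex `j` with `μ₀(e_i) = e_j`. -/
noncomputable def vertex (i : V) : W := (exists_vertex μ.zero i).choose

lemma zero_single (i : V) : μ.zero (Finsupp.single i 1) = Finsupp.single (μ.vertex i) 1 :=
  (exists_vertex μ.zero i).choose_spec

/-- The cotensor product `μ_{p₁} □ ⋯ □ μ_{pᵣ}`, as a linear combination of paths of length `r` of the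
augmented quiver; for `r = 0` it is the trivial path at `μ₀(e_a)`. -/
noncomputable def box {a : V} : {b : V} → Decomposition a b →
    (AugPath (μ.vertex a) (μ.vertex b) →₀ k)
  | _, .nil => Finsupp.single .nil 1
  | b, @Path.cons _ _ _ c _ d q =>
    (box d).sum fun r x =>
      (toAugArrows (μ.vertex c) (μ.vertex b) (μ.plus ⟨mkPath q.1, q.2⟩)).sum fun β y =>
        Finsupp.single (Path.cons r β) (x * y)

/-- The linear map `f_μ : kV → kW` with `f_μ(e_i) = μ₀(e_i)` and
`f_μ(p) = ∑_{p = p₁ ⋯ pᵣ} F(μ_{p₁} □ ⋯ □ μ_{pᵣ})` for nontrivial paths `p`, where the sum is over all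
decompositions of `p` into nontrivial paths. -/
noncomputable def toLinearMap : PathCoalgebra k V →ₗ[k] PathCoalgebra k W :=
  PathCoalgebra.lift k fun p =>
    ((decompositions p.path).map fun d => (μ.box d).sum fun q x => x • augValue k q).sum

variable (k V) in
/-- The trans-datum `𝟙` with `𝟙₀ = id`, `𝟙_α = α` for each arrow `α`, and `𝟙_p = 0` for each path `p`
of length at least two. -/
noncomputable def one : TransDatum k V V where
  zero := CoalgHom.id k _
  plus p := if p.1.path.length = 1 then PathCoalgebra.ofPath k p.1 else 0
  plus_mem := by
    rintro ⟨⟨a, b, p⟩, hp⟩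
    cases p with
    | nil => simp at hp
    | cons p α =>
      cases p with
      | cons p β => simp
      | nil =>
        simp [primitiveElements, vertexIncl, comul_ofPath, AnyPath.splits, splits]

end TransDatum

end TransData

end QuiverCoalgebra

/-! Dual algebras. Restriction to `D` makes `D^*` a quotient of the complete path algebra, and the
surjectivity of `σ ↦ σ^*` rests on the automatic continuity of algebra endomorphisms `φ` of `D^*`.
If a family `a` vanishes on the vertices, then `1 - c⁻¹a` is inverted by a geometric series.
Evaluation at a vertex is a character, so `φ(a)` cannot take a nonzero value `c` at a vertex
(`map_apply_vertex_eq_zero`). As there are finitely many arrows, a family vanishing on all paths of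
length at most `n` is a finite sum of products of a family vanishing below length `n` with an arrow
(`VanishesBelow.eq_sum`). By induction `φ` respects the length filtration
(`exists_vanishesBelow_map`). Hence `f ↦ φ(f)(x)` depends on finitely many coefficients only and is
evaluation at an element of `D` (`exists_adjoint`). The map `D → D` so obtained is a coalgebra
homomorphism because `φ` is unital and multiplicative. For `D = kQ^c` the dual algebra is the
complete path algebra, and inversion turns the anti-isomorphism into `Ψ`.

Trans-data. It suffices that `μ ↦ f_μ` is a bijection from trans-data to coalgebra endomorphisms:
composition, identity and units are then transported. That `f_μ` respects `Δ` comes from cutting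
decompositions (`sum_decompositions_splits`, `comul_value`). Since `F` is not multiplicative, an
auxiliary quantity `tail` is carried along, which records how a product of pieces continues when an
arrow of `Q` is appended. For bijectivity, `f_μ(p)` is `μ_p` plus terms that depend only on `μ` at
the vertices and at shorter paths (`AgreeBelow.toLinearMap_sub`), and two coalgebra homomorphisms
that agree on all paths shorter than `p` differ at `p` by a primitive element
(`sub_mem_primitiveElements`). So `μ_p` can be solved for, uniquely, by induction on the length. The
induction starts because group-like elements of `kQ^c` are vertices. -/

namespace QuiverCoalgebra

open Quiver WithConv

universe w u v u₁ v₁ u₂ v₂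

/-! ### Coefficients of elements and of their comultiplication -/

section Coefficients

variable {k : Type w} [Field k] {V : Type u} [Quiver.{v} V]

variable (k) in
/-- The coefficient of a path, as a linear form on the path coalgebra. -/
noncomputable def coeffForm (p : AnyPath V) : PathCoalgebra k V →ₗ[k] k := Finsupp.lapply p

lemma coeffForm_self (p : AnyPath V) : coeffForm k p (PathCoalgebra.ofPath k p) = 1 :=
  Finsupp.single_eq_same

lemma coeffForm_of_ne {p q : AnyPath V} (h : q ≠ p) :
    coeffForm k p (PathCoalgebra.ofPath k q) = 0 :=
  Finsupp.single_eq_of_ne' h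

open Classical in
lemma coeffForm_ofPath (p q : AnyPath V) :
    coeffForm k p (PathCoalgebra.ofPath k q) = if q = p then 1 else 0 := by
  split_ifs with h
  · rw [h, coeffForm_self]
  · exact coeffForm_of_ne h

lemma ext_coeffForm {x y : PathCoalgebra k V} (h : ∀ p, coeffForm k p x = coeffForm k p y) :
    x = y :=
  Finsupp.ext h

lemma exists_length_lt (x : PathCoalgebra k V) :
    ∃ n, ∀ p : AnyPath V, coeffForm k p x ≠ 0 → p.path.length < n := by
  refine ⟨(Finsupp.support (show AnyPath V →₀ k from x)).sup (fun p => p.path.length) + 1,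
    fun p hp => Nat.lt_succ_of_le ?_⟩
  exact Finset.le_sup (f := fun p : AnyPath V => p.path.length) (Finsupp.mem_support_iff.2 hp)

/-- The linear form on a tensor product given by two linear forms. -/
noncomputable def tensorForm {M N : Type*} [AddCommGroup M] [Module k M] [AddCommGroup N]
    [Module k N] (f : M →ₗ[k] k) (g : N →ₗ[k] k) : M ⊗[k] N →ₗ[k] k :=
  LinearMap.mul' k k ∘ₗ TensorProduct.map f g

@[simp] lemma tensorForm_tmul {M N : Type*} [AddCommGroup M] [Module k M] [AddCommGroup N]
    [Module k N] (f : M →ₗ[k] k) (g : N →ₗ[k] k) (x : M) (y : N) :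
    tensorForm f g (x ⊗ₜ[k] y) = f x * g y := rfl

lemma ext_tensorForm {x y : PathCoalgebra k V ⊗[k] PathCoalgebra k V}
    (h : ∀ p q, tensorForm (coeffForm k p) (coeffForm k q) x =
      tensorForm (coeffForm k p) (coeffForm k q) y) : x = y := by
  obtain ⟨e, he⟩ : ∃ e : PathCoalgebra k V ⊗[k] PathCoalgebra k V ≃ₗ[k]
      (AnyPath V × AnyPath V →₀ k), ∀ a b p q,
        e (a ⊗ₜ[k] b) (p, q) = coeffForm k p a * coeffForm k q b :=
    ⟨finsuppTensorFinsupp' k (AnyPath V) (AnyPath V),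
      fun a b p q => finsuppTensorFinsupp'_apply_apply _ _ _ _ _ _ _⟩
  apply e.injective
  ext ⟨p, q⟩
  have key : ∀ z, e z (p, q) = tensorForm (coeffForm k p) (coeffForm k q) z := by
    intro z
    induction z with
    | zero => simp
    | add a b ha hb => rw [map_add, map_add, ← ha, ← hb]; rfl
    | tmul a b => exact he a b p q
  rw [key, key, h]

lemma mem_anyPath_splits {p : AnyPath V} {s : AnyPath V × AnyPath V} :
    s ∈ p.splits ↔ ∃ (c : V) (x : Path p.src c) (y : Path c p.tgt),
      x.comp y = p.path ∧ s = (mkPath x, mkPath y) := by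
  simp only [AnyPath.splits, List.mem_map, mem_splits]
  constructor
  · rintro ⟨⟨c, x, y⟩, h, rfl⟩
    exact ⟨c, x, y, h, rfl⟩
  · rintro ⟨c, x, y, h, rfl⟩
    exact ⟨⟨c, x, y⟩, h, rfl⟩

lemma nodup_anyPath_splits (p : AnyPath V) : p.splits.Nodup := by
  refine (nodup_splits p.path).map ?_
  rintro ⟨c, x, y⟩ ⟨d, x', y'⟩ h
  simp only [Prod.mk.injEq] at h
  obtain ⟨h1, h2⟩ := h
  cases h1; cases h2; rfl

lemma length_of_mem_splits {p : AnyPath V} {s : AnyPath V × AnyPath V} (h : s ∈ p.splits) :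
    s.1.path.length + s.2.path.length = p.path.length := by
  obtain ⟨c, x, y, hp, rfl⟩ := mem_anyPath_splits.1 h
  rw [← hp, Path.length_comp]

open Classical in
lemma tensorForm_comul_ofPath (p q r : AnyPath V) :
    tensorForm (coeffForm k p) (coeffForm k q)
      (Coalgebra.comul (R := k) (PathCoalgebra.ofPath k r)) =
      if (p, q) ∈ r.splits then 1 else 0 := by
  rw [comul_ofPath, map_list_sum, List.map_map]
  have : (fun s : AnyPath V × AnyPath V => tensorForm (coeffForm k p) (coeffForm k q)
      (PathCoalgebra.ofPath k s.1 ⊗ₜ[k] PathCoalgebra.ofPath k s.2)) =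
      fun s => if s = (p, q) then 1 else 0 := by
    funext s
    simp only [tensorForm_tmul, coeffForm_ofPath, Prod.ext_iff]
    split_ifs <;> simp_all
  rw [Function.comp_def, this]
  have key : ∀ l : List (AnyPath V × AnyPath V), l.Nodup →
      (l.map fun s => if s = (p, q) then (1 : k) else 0).sum = if (p, q) ∈ l then 1 else 0 := by
    intro l hl
    induction l with
    | nil => simp
    | cons s l ih =>
      rw [List.nodup_cons] at hl
      rw [List.map_cons, List.sum_cons, ih hl.2]
      by_cases hs : s = (p, q)
      · subst hs; simp [hl.1]
      · simp [hs, Ne.symm hs]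
  exact key _ (nodup_anyPath_splits r)

/-- Composable paths form a splitting of exactly one path, their composite. Together with
`tensorForm_comul_of_ne` this turns identities for `Δ` into identities between coefficients, which
is how primitive and group-like elements are determined. -/
lemma tensorForm_comul_comp {a b c : V} (p : Path a b) (q : Path b c) (x : PathCoalgebra k V) :
    tensorForm (coeffForm k (mkPath p)) (coeffForm k (mkPath q)) (Coalgebra.comul (R := k) x) =
      coeffForm k (mkPath (p.comp q)) x := by
  classical
  have : tensorForm (coeffForm k (mkPath p)) (coeffForm k (mkPath q)) ∘ₗ
      Coalgebra.comul (R := k) = coeffForm k (mkPath (p.comp q)) := by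
    refine PathCoalgebra.hom_ext fun r => ?_
    rw [LinearMap.comp_apply, tensorForm_comul_ofPath, coeffForm_ofPath]
    congr 1
    rw [mem_anyPath_splits, eq_iff_iff]
    constructor
    · rintro ⟨d, x, y, h, he⟩
      obtain ⟨a', c', r⟩ := r
      simp only [Prod.mk.injEq] at he
      obtain ⟨h1, h2⟩ := he
      cases h1; cases h2
      exact congrArg mkPath h.symm
    · rintro rfl
      exact ⟨b, p, q, rfl, rfl⟩
  exact LinearMap.congr_fun this x

lemma tensorForm_comul_of_ne {p q : AnyPath V} (h : p.tgt ≠ q.src) (x : PathCoalgebra k V) :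
    tensorForm (coeffForm k p) (coeffForm k q) (Coalgebra.comul (R := k) x) = 0 := by
  classical
  have : tensorForm (coeffForm k p) (coeffForm k q) ∘ₗ Coalgebra.comul (R := k) = 0 := by
    refine PathCoalgebra.hom_ext fun r => ?_
    rw [LinearMap.comp_apply, tensorForm_comul_ofPath, if_neg]
    · rfl
    · rw [mem_anyPath_splits]
      rintro ⟨d, x, y, -, he⟩
      simp only [Prod.mk.injEq] at he
      obtain ⟨rfl, rfl⟩ := he
      exact h rfl
  exact LinearMap.congr_fun this x

end Coefficients

/-! ### Finiteness of the set of paths of bounded length -/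

section Finiteness

variable {V : Type u} [Quiver.{v} V] [Finite V] [∀ a b : V, Finite (a ⟶ b)]

lemma finite_length_eq (n : ℕ) : {p : AnyPath V | p.path.length = n}.Finite := by
  induction n with
  | zero =>
    refine (Set.finite_range fun a : V => (mkPath (.nil : Path a a))).subset ?_
    rintro ⟨a, b, p⟩ h
    cases p with
    | nil => exact ⟨a, rfl⟩
    | cons p α => simp at h
  | succ n ih =>
    have := ih.to_subtype
    refine (Set.finite_range fun x : Σ p : {p : AnyPath V | p.path.length = n},
      Σ c : V, (p.1.tgt ⟶ c) => (mkPath (x.1.1.path.cons x.2.2))).subset ?_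
    rintro ⟨a, b, p⟩ h
    cases p with
    | nil => simp at h
    | cons p α => exact ⟨⟨⟨mkPath p, by simpa using h⟩, _, α⟩, rfl⟩

lemma finite_length_lt (n : ℕ) : {p : AnyPath V | p.path.length < n}.Finite := by
  refine ((Set.finite_lt_nat n).biUnion fun m _ => finite_length_eq (V := V) m).subset ?_
  intro p hp
  simpa using hp

end Finiteness

/-! ### The length filtration of the complete path algebra -/

namespace CompletePathAlgebra

variable {k : Type w} [Field k] {V : Type u} [Quiver.{v} V]

/-- The family vanishes on all paths of length less than `n`. -/
def VanishesBelow (n : ℕ) (a : CompletePathAlgebra k V) : Prop :=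
  ∀ p : AnyPath V, p.path.length < n → a p = 0

lemma sum_apply {ι : Type*} (s : Finset ι) (f : ι → CompletePathAlgebra k V) (p : AnyPath V) :
    (∑ i ∈ s, f i) p = ∑ i ∈ s, f i p :=
  Finset.sum_apply p s f

lemma VanishesBelow.sum {ι : Type*} {n : ℕ} {s : Finset ι} {f : ι → CompletePathAlgebra k V}
    (h : ∀ i ∈ s, VanishesBelow n (f i)) : VanishesBelow n (∑ i ∈ s, f i) := by
  intro p hp
  rw [sum_apply]
  exact Finset.sum_eq_zero fun i hi => h i hi p hp

lemma VanishesBelow.mul {m n : ℕ} {a b : CompletePathAlgebra k V} (ha : VanishesBelow m a)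
    (hb : VanishesBelow n b) : VanishesBelow (m + n) (a * b) := by
  intro p hp
  rw [mul_apply]
  refine List.sum_eq_zero fun x hx => ?_
  obtain ⟨s, hs, rfl⟩ := List.mem_map.1 hx
  have := length_of_mem_splits hs
  by_cases h : s.1.path.length < m
  · simp [ha _ h]
  · simp [hb s.2 (by omega)]

lemma VanishesBelow.pow {a : CompletePathAlgebra k V} (ha : VanishesBelow 1 a) (n : ℕ) :
    VanishesBelow n (a ^ n) := by
  induction n with
  | zero => intro p hp; simp at hp
  | succ n ih => rw [pow_succ]; exact ih.mul ha

lemma sub_apply (a b : CompletePathAlgebra k V) (p : AnyPath V) : (a - b) p = a p - b p := rfl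

lemma mul_congr_right {a b c : CompletePathAlgebra k V} {p : AnyPath V}
    (h : ∀ q : AnyPath V, q.path.length ≤ p.path.length → b q = c q) :
    (a * b) p = (a * c) p := by
  rw [mul_apply, mul_apply]
  refine congrArg _ (List.map_congr_left fun s hs => ?_)
  have := length_of_mem_splits hs
  rw [h _ (by omega)]

/-- The geometric series inverts `1 - a` if `a` vanishes on the vertices. -/
lemma VanishesBelow.exists_mul_eq_one {a : CompletePathAlgebra k V} (ha : VanishesBelow 1 a) :
    ∃ b, (1 - a) * b = 1 := by
  -- Since `a ^ n` vanishes on paths shorter than `n`, the series may be cut off at the length of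
  -- the path. A product at `p` involves only paths no longer than `p`, so the truncation chosen for
  -- `p` serves for all of them.
  obtain ⟨b, hb⟩ : ∃ b : CompletePathAlgebra k V,
      ∀ p, b p = (∑ n ∈ Finset.range (p.path.length + 1), a ^ n) p := ⟨fun p => _, fun _ => rfl⟩
  refine ⟨b, ?_⟩
  ext p
  have h : ((1 - a) * b) p = ((1 - a) * ∑ n ∈ Finset.range (p.path.length + 1), a ^ n) p := by
    refine mul_congr_right fun q hq => ?_
    rw [hb, sum_apply, sum_apply]
    refine Finset.sum_subset (Finset.range_mono (by omega)) fun n _ hn => ?_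
    exact ha.pow n q (by simpa using hn)
  rw [h, mul_neg_geom_sum, sub_apply, ha.pow _ p (Nat.lt_succ_self _), sub_zero]

open Classical in
/-- The family with value `1` at the path `p` and `0` elsewhere. -/
noncomputable def single (k : Type w) [Field k] (p : AnyPath V) : CompletePathAlgebra k V :=
  fun q => if q = p then 1 else 0

open Classical in
lemma single_apply (p q : AnyPath V) : single k p q = if q = p then 1 else 0 := rfl

/-- The set of all arrows. -/
abbrev Arrow (V : Type u) [Quiver.{v} V] := Σ a b : V, (a ⟶ b)

open Classical in
/-- The family `p ↦ a_{pα}`. -/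
noncomputable def shift (α : Arrow V) (a : CompletePathAlgebra k V) : CompletePathAlgebra k V :=
  fun p => if h : p.tgt = α.1 then a (mkPath ((p.path.cast rfl h).cons α.2.2)) else 0

lemma VanishesBelow.shift {n : ℕ} {a : CompletePathAlgebra k V} (ha : VanishesBelow (n + 1) a)
    (α : Arrow V) : VanishesBelow n (shift α a) := by
  intro p hp
  obtain ⟨x, y, p⟩ := p
  obtain ⟨c, d, α⟩ := α
  rw [CompletePathAlgebra.shift]
  split_ifs with h
  · obtain rfl : y = c := h
    exact ha _ (by simpa using hp)
  · rfl

open Classical in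
lemma mul_single_cons (a : CompletePathAlgebra k V) (α : Arrow V) {x y z : V} (p : Path x y)
    (β : y ⟶ z) :
    (a * single k (mkPath α.2.2.toPath)) (mkPath (p.cons β)) =
      if (⟨y, z, β⟩ : Arrow V) = α then a (mkPath p) else 0 := by
  obtain ⟨c, d, α⟩ := α
  have key : ∀ {e : V} (q : Path e y), (mkPath (q.cons β) : AnyPath V) = mkPath α.toPath ↔
      q.length = 0 ∧ (⟨y, z, β⟩ : Arrow V) = ⟨c, d, α⟩ := by
    intro e q
    constructor
    · intro h
      cases q with
      | nil =>
        simp only [Hom.toPath, AnyPath.mk.injEq] at h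
        obtain ⟨rfl, rfl, h⟩ := h
        cases h
        exact ⟨rfl, rfl⟩
      | cons q γ => simpa using congrArg (fun r : AnyPath V => r.path.length) h
    · rintro ⟨h1, h2⟩
      cases q with
      | nil => cases h2; rfl
      | cons q γ => simp at h1
  have hnil : (mkPath (.nil : Path z z) : AnyPath V) ≠ mkPath α.toPath := fun h => by
    simpa using congrArg (fun r : AnyPath V => r.path.length) h
  -- Read backwards, this writes the right-hand side as a sum over the splittings of `p`, to be
  -- matched termwise with the splittings of `pβ` that keep `β` in the second factor.
  have h2 := AnyPath.splits_right (mkPath p) fun q =>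
    if (⟨y, z, β⟩ : Arrow V) = ⟨c, d, α⟩ then a q else 0
  rw [← h2, mul_apply]
  simp only [AnyPath.splits, splits, List.map_append, List.map_map, List.sum_append,
    Function.comp_def, List.map_cons, List.map_nil, List.sum_cons, List.sum_nil, single_apply, key,
    hnil, if_false, mul_zero, add_zero]
  congr 1
  refine List.map_congr_left fun s _ => ?_
  split_ifs <;> simp_all

/-- A nontrivial path has exactly one last arrow, so a single summand contributes to each
coefficient. As `shift` lowers the order of vanishing by one, this factors the filtration through
its first step. -/
lemma VanishesBelow.eq_sum [Fintype (Arrow V)] {a : CompletePathAlgebra k V}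
    (ha : VanishesBelow 1 a) :
    a = ∑ α : Arrow V, CompletePathAlgebra.shift α a * single k (mkPath α.2.2.toPath) := by
  classical
  ext ⟨x, z, p⟩
  rw [sum_apply]
  cases p with
  | nil =>
    rw [ha _ (by simp), Finset.sum_eq_zero]
    intro α _
    simp only [mul_apply, AnyPath.splits, splits, List.map_cons, List.map_nil, List.sum_cons,
      List.sum_nil, add_zero, single_apply]
    rw [if_neg, mul_zero]
    intro h
    simpa using congrArg (fun r : AnyPath V => r.path.length) h
  | cons p β =>
    simp only [mul_single_cons, Finset.sum_ite_eq, Finset.mem_univ, if_true]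
    simp [CompletePathAlgebra.shift]

lemma vanishesBelow_single {p : AnyPath V} {n : ℕ} (h : n ≤ p.path.length) :
    VanishesBelow n (single k p) := by
  classical
  intro q hq
  rw [single_apply, if_neg]
  rintro rfl
  omega

end CompletePathAlgebra

/-! ### Algebra endomorphisms of a dual algebra and their adjoints -/

section Dual

variable {k : Type w} [Field k] {V : Type u} [Quiver.{v} V]

lemma pairing_ofPath (a : CompletePathAlgebra k V) (p : AnyPath V) :
    pairing k V a (PathCoalgebra.ofPath k p) = a p :=
  PathCoalgebra.lift_ofPath k a p

lemma pairing_add (a b : CompletePathAlgebra k V) :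
    pairing k V (a + b) = pairing k V a + pairing k V b :=
  PathCoalgebra.hom_ext fun p => by
    simp [pairing_ofPath, CompletePathAlgebra.add_apply]

lemma pairing_smul (c : k) (a : CompletePathAlgebra k V) :
    pairing k V (c • a) = c • pairing k V a :=
  PathCoalgebra.hom_ext fun p => by
    simp [pairing_ofPath, CompletePathAlgebra.smul_apply]

lemma pairing_one : pairing k V 1 = Coalgebra.counit (R := k) :=
  PathCoalgebra.hom_ext fun p => by
    rw [pairing_ofPath, counit_ofPath, CompletePathAlgebra.one_apply]

lemma pairing_mul (a b : CompletePathAlgebra k V) :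
    pairing k V (a * b) = tensorForm (pairing k V a) (pairing k V b) ∘ₗ Coalgebra.comul :=
  PathCoalgebra.hom_ext fun p => by
    rw [LinearMap.comp_apply, comul_ofPath, map_list_sum, List.map_map, pairing_ofPath,
      CompletePathAlgebra.mul_apply]
    simp [Function.comp_def, pairing_ofPath]

lemma pairing_apply_eq_zero {n : ℕ} {a : CompletePathAlgebra k V}
    (ha : CompletePathAlgebra.VanishesBelow n a) {x : PathCoalgebra k V}
    (hx : ∀ p : AnyPath V, coeffForm k p x ≠ 0 → p.path.length < n) :
    pairing k V a x = 0 := by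
  change Finsupp.sum (show AnyPath V →₀ k from x) (fun p c => c • a p) = 0
  refine Finset.sum_eq_zero fun p hp => ?_
  have h : a p = 0 := ha p (hx p (Finsupp.mem_support_iff.1 hp))
  exact (congrArg _ h).trans (smul_zero _)

variable {D : Type*} [AddCommGroup D] [Module k D] [Coalgebra k D]

/-- The algebra homomorphism from the complete path algebra to the dual algebra of a coalgebra `D`
induced by a coalgebra homomorphism from `D` to the path coalgebra. -/
noncomputable def restrictDual (ι : D →ₗc[k] PathCoalgebra k V) :
    CompletePathAlgebra k V →ₐ[k] WithConv (D →ₗ[k] k) :=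
  AlgHom.ofLinearMap
    { toFun := fun a => toConv (pairing k V a ∘ₗ ι.toLinearMap)
      map_add' := fun a b => by
        ext x; simp [pairing_add]
      map_smul' := fun c a => by
        ext x; simp [pairing_smul] }
    (by
      ext x
      simp [pairing_one])
    (fun a b => by
      ext x
      change pairing k V (a * b) (ι x) = LinearMap.mul' k k (TensorProduct.map
        (pairing k V a ∘ₗ ι.toLinearMap) (pairing k V b ∘ₗ ι.toLinearMap) (Coalgebra.comul x))
      rw [pairing_mul, LinearMap.comp_apply, ← CoalgHomClass.map_comp_comul_apply, tensorForm,
        LinearMap.comp_apply, TensorProduct.map_comp]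
      rfl)

lemma restrictDual_apply (ι : D →ₗc[k] PathCoalgebra k V) (a : CompletePathAlgebra k V) (x : D) :
    restrictDual ι a x = pairing k V a (ι x) := rfl

/-- A linear retraction of `ι` extends every form on `D` to the path coalgebra; its values on paths
are the required family. -/
lemma restrictDual_surjective {ι : D →ₗc[k] PathCoalgebra k V} (hι : Function.Injective ι) :
    Function.Surjective (restrictDual ι) := by
  intro f
  obtain ⟨r, hr⟩ := LinearMap.exists_leftInverse_of_injective ι.toLinearMap
    (LinearMap.ker_eq_bot.2 hι)
  refine ⟨fun p => f (r (PathCoalgebra.ofPath k p)), ?_⟩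
  have h : pairing k V (fun p => f (r (PathCoalgebra.ofPath k p))) = f.ofConv ∘ₗ r :=
    PathCoalgebra.hom_ext fun p => pairing_ofPath _ p
  ext x
  change pairing k V _ (ι x) = _
  rw [h]
  exact congrArg f.ofConv (LinearMap.congr_fun hr x)

open CompletePathAlgebra

variable {ι : D →ₗc[k] PathCoalgebra k V}

/-- A vertex is group-like, so evaluation at it is a character of the dual algebra. -/
lemma mul_apply_of_vertex (hι : Function.Injective ι) {i : V} {y : D}
    (hy : ι y = PathCoalgebra.ofPath k (mkPath (.nil : Path i i)))
    (f g : WithConv (D →ₗ[k] k)) : (f * g) y = f y * g y := by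
  obtain ⟨a, rfl⟩ := restrictDual_surjective hι f
  obtain ⟨b, rfl⟩ := restrictDual_surjective hι g
  rw [← map_mul, restrictDual_apply, restrictDual_apply, restrictDual_apply, hy, pairing_ofPath,
    pairing_ofPath, pairing_ofPath, CompletePathAlgebra.mul_apply]
  simp [AnyPath.splits, splits]

lemma one_apply_of_vertex {i : V} {y : D}
    (hy : ι y = PathCoalgebra.ofPath k (mkPath (.nil : Path i i))) :
    (1 : WithConv (D →ₗ[k] k)) y = 1 := by
  rw [← map_one (restrictDual ι), restrictDual_apply, hy, pairing_ofPath,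
    CompletePathAlgebra.one_apply]
  simp

/-- Algebra endomorphisms of the dual algebra preserve the Jacobson radical. -/
lemma map_apply_vertex_eq_zero (hι : Function.Injective ι)
    (φ : WithConv (D →ₗ[k] k) →ₐ[k] WithConv (D →ₗ[k] k)) {a : CompletePathAlgebra k V}
    (ha : VanishesBelow 1 a) {i : V} {y : D}
    (hy : ι y = PathCoalgebra.ofPath k (mkPath (.nil : Path i i))) :
    φ (restrictDual ι a) y = 0 := by
  by_contra hc
  set c := φ (restrictDual ι a) y with hcdef
  -- After scaling, `φ` sends the invertible element `1 - c⁻¹a` to a form with value `0` at `y`.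
  -- Multiplicativity of evaluation at `y` then gives `0 = 1`.
  have hca : VanishesBelow 1 (c⁻¹ • a) := fun p hp => by
    rw [CompletePathAlgebra.smul_apply, ha p hp, mul_zero]
  obtain ⟨b, hb⟩ := hca.exists_mul_eq_one
  have h := congrArg (fun a => φ (restrictDual ι a) y) hb
  simp only [map_mul, map_sub, map_one, map_smul, mul_apply_of_vertex hι hy] at h
  have h1 : (1 - c⁻¹ • φ (restrictDual ι a)) y = 0 := by
    change (1 : WithConv (D →ₗ[k] k)) y - c⁻¹ * φ (restrictDual ι a) y = 0
    rw [one_apply_of_vertex hy, ← hcdef, inv_mul_cancel₀ hc, sub_self]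
  rw [h1, one_apply_of_vertex hy, zero_mul] at h
  exact zero_ne_one h

variable [Finite V] [∀ a b : V, Finite (a ⟶ b)]

/-- Continuity of `φ` for the length filtration. The case `n = 1` is `map_apply_vertex_eq_zero`, and
`VanishesBelow.eq_sum` reduces `n + 1` to products of the cases `n` and `1`. The sum over arrows
must be finite for `φ` to commute with it. -/
lemma exists_vanishesBelow_map (hι : Function.Injective ι)
    (hvert : ∀ i : V, ∃ y, ι y = PathCoalgebra.ofPath k (mkPath (.nil : Path i i)))
    (φ : WithConv (D →ₗ[k] k) →ₐ[k] WithConv (D →ₗ[k] k)) (n : ℕ) :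
    ∀ a : CompletePathAlgebra k V, VanishesBelow n a →
      ∃ b, VanishesBelow n b ∧ φ (restrictDual ι a) = restrictDual ι b := by
  have h1 : ∀ a : CompletePathAlgebra k V, VanishesBelow 1 a →
      ∃ b, VanishesBelow 1 b ∧ φ (restrictDual ι a) = restrictDual ι b := by
    intro a ha
    obtain ⟨b, hb⟩ := restrictDual_surjective hι (φ (restrictDual ι a))
    refine ⟨b, ?_, hb.symm⟩
    rintro ⟨i, j, p⟩ hp
    cases p with
    | cons p α => simp at hp
    | nil =>
      obtain ⟨y, hy⟩ := hvert i
      refine (pairing_ofPath b _).symm.trans ?_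
      rw [← hy, ← restrictDual_apply, hb]
      exact map_apply_vertex_eq_zero hι φ ha hy
  induction n with
  | zero =>
    intro a _
    obtain ⟨b, hb⟩ := restrictDual_surjective hι (φ (restrictDual ι a))
    exact ⟨b, fun p hp => absurd hp (Nat.not_lt_zero _), hb.symm⟩
  | succ n ih =>
    intro a ha
    have := Fintype.ofFinite (Arrow V)
    choose b hb hb' using fun α : Arrow V => ih (shift α a) (ha.shift α)
    choose c hc hc' using fun α : Arrow V =>
      h1 (single k (mkPath α.2.2.toPath)) (vanishesBelow_single (by simp [Path.length_toPath]))
    refine ⟨∑ α, b α * c α, .sum fun α _ => (hb α).mul (hc α), ?_⟩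
    have ha1 : VanishesBelow 1 a := fun p hp => ha p (by omega)
    conv_lhs => rw [ha1.eq_sum]
    simp only [map_sum, map_mul, hb', hc']

/-- Algebra endomorphisms of the dual algebra are adjoint to maps of the coalgebra. -/
lemma exists_adjoint (hι : Function.Injective ι)
    (hvert : ∀ i : V, ∃ y, ι y = PathCoalgebra.ofPath k (mkPath (.nil : Path i i)))
    (φ : WithConv (D →ₗ[k] k) →ₐ[k] WithConv (D →ₗ[k] k)) (x : D) :
    ∃ y : D, ∀ f : WithConv (D →ₗ[k] k), φ f x = f y := by
  classical
  obtain ⟨n, hn⟩ := exists_length_lt (ι x)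
  have hzero : ∀ a : CompletePathAlgebra k V, VanishesBelow n a → φ (restrictDual ι a) x = 0 := by
    intro a ha
    obtain ⟨b, hb, h⟩ := exists_vanishesBelow_map hι hvert φ n a ha
    rw [h, restrictDual_apply, pairing_apply_eq_zero hb hn]
  -- Modulo families vanishing below `n`, a family is a combination of the indicators of the
  -- finitely many shorter paths. The values of `φ(·)(x)` on these indicators are therefore the
  -- coefficients of the sought element `z`.
  let S : Finset (AnyPath V) := (finite_length_lt (V := V) n).toFinset
  let z : PathCoalgebra k V :=
    ∑ p ∈ S, φ (restrictDual ι (single k p)) x • PathCoalgebra.ofPath k p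
  have hz : ∀ a : CompletePathAlgebra k V, φ (restrictDual ι a) x = pairing k V a z := by
    intro a
    have h : VanishesBelow n (a - ∑ p ∈ S, a p • single k p) := by
      intro q hq
      rw [CompletePathAlgebra.sub_apply, CompletePathAlgebra.sum_apply,
        Finset.sum_eq_single q, CompletePathAlgebra.smul_apply, single_apply, if_pos rfl, mul_one,
        sub_self]
      · intro p _ hp
        rw [CompletePathAlgebra.smul_apply, single_apply, if_neg hp.symm, mul_zero]
      · intro h
        exact absurd ((finite_length_lt (V := V) n).mem_toFinset.2 hq) h
    have h0 := hzero _ h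
    rw [map_sub, map_sub, map_sum, map_sum] at h0
    have h1 : φ (restrictDual ι a) x = (∑ p ∈ S, φ (restrictDual ι (a p • single k p))) x :=
      sub_eq_zero.1 h0
    have h2 : ∀ (T : Finset (AnyPath V)) (g : AnyPath V → WithConv (D →ₗ[k] k)),
        (∑ p ∈ T, g p) x = ∑ p ∈ T, g p x := by
      intro T g
      induction T using Finset.induction_on with
      | empty => rfl
      | insert p T hp ih => rw [Finset.sum_insert hp, Finset.sum_insert hp, ← ih]; rfl
    rw [h1, h2, map_sum]
    refine Finset.sum_congr rfl fun p _ => ?_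
    rw [map_smul, map_smul, map_smul, pairing_ofPath, smul_eq_mul, mul_comm]
    rfl
  -- A form vanishing on the image of `ι` restricts to zero on `D`, so by `hz` it vanishes at `z`
  -- too; no form can separate `z` from the image.
  have hmem : z ∈ LinearMap.range ι.toLinearMap := by
    by_contra hmem
    obtain ⟨f, hf, hf'⟩ := Submodule.exists_le_ker_of_notMem hmem
    have hfa : pairing k V (fun p => f (PathCoalgebra.ofPath k p)) = f :=
      PathCoalgebra.hom_ext fun p => pairing_ofPath _ p
    have hr : restrictDual ι (fun p => f (PathCoalgebra.ofPath k p)) = 0 := by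
      ext y
      change pairing k V _ (ι y) = 0
      rw [hfa]
      exact hf' ⟨y, rfl⟩
    have := hz (fun p => f (PathCoalgebra.ofPath k p))
    rw [hr, map_zero, hfa] at this
    exact hf this.symm
  obtain ⟨y, hy⟩ := hmem
  refine ⟨y, fun f => ?_⟩
  obtain ⟨a, rfl⟩ := restrictDual_surjective hι f
  rw [hz, ← hy]
  rfl

end Dual

/-! ### Automorphisms of a coalgebra and of its dual algebra -/

section DualAutomorphisms

variable {k : Type w} [Field k] {D : Type*} [AddCommGroup D] [Module k D]

lemma eq_of_forall_dual {x y : D} (h : ∀ f : WithConv (D →ₗ[k] k), f x = f y) : x = y := by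
  rw [← sub_eq_zero, ← Module.forall_dual_apply_eq_zero_iff k]
  intro f
  rw [map_sub, sub_eq_zero]
  exact h (toConv f)

variable [Coalgebra k D]

/-- Precomposition with a coalgebra homomorphism, as a homomorphism of dual algebras. -/
noncomputable def dualAlgHom (σ : D →ₗc[k] D) : WithConv (D →ₗ[k] k) →ₐ[k] WithConv (D →ₗ[k] k) :=
  AlgHom.ofLinearMap
    { toFun := fun f => toConv (f.ofConv ∘ₗ σ.toLinearMap)
      map_add' := fun f g => rfl
      map_smul' := fun c f => rfl }
    (by ext x; simp)
    (fun f g => congrArg toConv (LinearMap.convMul_comp_coalgHom_distrib f g σ))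

/-- The action of coalgebra automorphisms on the dual algebra. -/
noncomputable def dualAut :
    (D ≃ₗc[k] D) →* (WithConv (D →ₗ[k] k) ≃ₐ[k] WithConv (D →ₗ[k] k))ᵐᵒᵖ where
  toFun σ := .op <| AlgEquiv.ofAlgHom (dualAlgHom σ.toCoalgHom) (dualAlgHom σ.symm.toCoalgHom)
    (by
      ext f x
      exact congrArg f.ofConv (σ.symm_apply_apply x))
    (by
      ext f x
      exact congrArg f.ofConv (σ.apply_symm_apply x))
  map_one' := rfl
  map_mul' _ _ := rfl

lemma dualAut_apply (σ : D ≃ₗc[k] D) (f : WithConv (D →ₗ[k] k)) (x : D) :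
    (dualAut σ).unop f x = f (σ x) := rfl

lemma dualAut_injective : Function.Injective (dualAut (k := k) (D := D)) := by
  intro σ τ h
  refine CoalgEquiv.ext fun x => eq_of_forall_dual (k := k) fun f => ?_
  rw [← dualAut_apply, ← dualAut_apply, h]

variable {V : Type u} [Quiver.{v} V] {ι : D →ₗc[k] PathCoalgebra k V}

/-- Elementary tensors of linear forms separate the points of the tensor square. -/
lemma tensor_eq_of_forall_dual (hι : Function.Injective ι) {x y : D ⊗[k] D}
    (h : ∀ f g : D →ₗ[k] k, tensorForm f g x = tensorForm f g y) : x = y := by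
  apply Subcoalgebra.map_injective ι.toLinearMap ι.toLinearMap hι hι
  refine ext_tensorForm fun p q => ?_
  have := h (coeffForm k p ∘ₗ ι.toLinearMap) (coeffForm k q ∘ₗ ι.toLinearMap)
  simpa only [tensorForm, TensorProduct.map_comp, LinearMap.comp_apply] using this

variable [Finite V] [∀ a b : V, Finite (a ⟶ b)]

/-- Forms on `D`, and products of forms on `D ⊗ D`, separate points. Tested against them, additivity
and homogeneity of the adjoint become those of the forms `φ f`, while compatibility with `ε` and `Δ`
becomes `φ 1 = 1` and multiplicativity of `φ`. -/
lemma exists_coalgHom_adjoint (hι : Function.Injective ι)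
    (hvert : ∀ i : V, ∃ y, ι y = PathCoalgebra.ofPath k (mkPath (.nil : Path i i)))
    (φ : WithConv (D →ₗ[k] k) →ₐ[k] WithConv (D →ₗ[k] k)) :
    ∃ σ : D →ₗc[k] D, ∀ f x, φ f x = f (σ x) := by
  choose s hs using exists_adjoint hι hvert φ
  let l : D →ₗ[k] D :=
    { toFun := s
      map_add' := fun x y => eq_of_forall_dual (k := k) fun f => by
        rw [← hs]
        refine ((φ f).ofConv.map_add x y).trans ?_
        refine Eq.trans ?_ (f.ofConv.map_add (s x) (s y)).symm
        exact congrArg₂ _ (hs x f) (hs y f)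
      map_smul' := fun c x => eq_of_forall_dual (k := k) fun f => by
        rw [← hs]
        refine ((φ f).ofConv.map_smul c x).trans ?_
        refine Eq.trans ?_ (f.ofConv.map_smul c (s x)).symm
        exact congrArg _ (hs x f) }
  refine ⟨⟨l, ?_, ?_⟩, fun f x => hs x f⟩
  · ext x
    have h := hs x 1
    rw [map_one] at h
    exact h.symm
  · ext x
    refine tensor_eq_of_forall_dual hι fun f g => ?_
    have hf : f ∘ₗ l = (φ (toConv f)).ofConv := LinearMap.ext fun y => (hs y (toConv f)).symm
    have hg : g ∘ₗ l = (φ (toConv g)).ofConv := LinearMap.ext fun y => (hs y (toConv g)).symm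
    -- The convolution product is `tensorForm` after `comul`, so multiplicativity of `φ`, evaluated
    -- at `x`, is the identity to be shown.
    have h := hs x (toConv f * toConv g)
    rw [map_mul] at h
    change tensorForm f g (TensorProduct.map l l (Coalgebra.comul x)) =
      tensorForm f g (Coalgebra.comul (s x))
    rw [tensorForm, LinearMap.comp_apply, LinearMap.comp_apply, ← LinearMap.comp_apply
      (TensorProduct.map f g), ← TensorProduct.map_comp, hf, hg]
    exact h

lemma dualAut_surjective (hι : Function.Injective ι)
    (hvert : ∀ i : V, ∃ y, ι y = PathCoalgebra.ofPath k (mkPath (.nil : Path i i))) :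
    Function.Surjective (dualAut (k := k) (D := D)) := by
  intro φ
  obtain ⟨σ, hσ⟩ := exists_coalgHom_adjoint hι hvert φ.unop.toAlgHom
  obtain ⟨τ, hτ⟩ := exists_coalgHom_adjoint hι hvert φ.unop.symm.toAlgHom
  have hσ' : ∀ f x, φ.unop f x = f (σ x) := hσ
  have hτ' : ∀ f x, φ.unop.symm f x = f (τ x) := hτ
  refine ⟨CoalgEquiv.ofCoalgHom σ τ ?_ ?_, ?_⟩
  · refine CoalgHom.ext fun x => eq_of_forall_dual (k := k) fun f => ?_
    change f (σ (τ x)) = f x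
    rw [← hσ', ← hτ', AlgEquiv.symm_apply_apply]
  · refine CoalgHom.ext fun x => eq_of_forall_dual (k := k) fun f => ?_
    change f (τ (σ x)) = f x
    rw [← hτ', ← hσ', AlgEquiv.apply_symm_apply]
  · refine MulOpposite.unop_injective (AlgEquiv.ext fun f => ?_)
    ext x
    exact (hσ' f x).symm

/-- The automorphism group of a coalgebra `D` embedded into the path coalgebra of a finite quiver,
with image containing all vertices, is anti-isomorphic to that of the dual algebra. -/
noncomputable def dualAutEquiv (hι : Function.Injective ι)
    (hvert : ∀ i : V, ∃ y, ι y = PathCoalgebra.ofPath k (mkPath (.nil : Path i i))) :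
    (D ≃ₗc[k] D) ≃* (WithConv (D →ₗ[k] k) ≃ₐ[k] WithConv (D →ₗ[k] k))ᵐᵒᵖ :=
  MulEquiv.ofBijective dualAut ⟨dualAut_injective, dualAut_surjective hι hvert⟩

lemma dualAutEquiv_apply (hι : Function.Injective ι)
    (hvert : ∀ i : V, ∃ y, ι y = PathCoalgebra.ofPath k (mkPath (.nil : Path i i)))
    (σ : D ≃ₗc[k] D) (f : WithConv (D →ₗ[k] k)) (x : D) :
    (dualAutEquiv hι hvert σ).unop f x = f (σ x) := rfl

end DualAutomorphisms

/-! ### The complete path algebra as a dual algebra -/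

section PathAlgebra

variable {k : Type w} [Field k] {V : Type u} [Quiver.{v} V]

/-- The inclusion of a subcoalgebra, as a coalgebra homomorphism. -/
noncomputable def Subcoalgebra.subtype {C : Type*} [AddCommGroup C] [Module k C] [Coalgebra k C]
    (D : Subcoalgebra k C) : D.toSubmodule →ₗc[k] C where
  toLinearMap := D.toSubmodule.subtype
  counit_comp := rfl
  map_comp_comul := D.map_comp_comul

variable (k V) in
/-- The complete path algebra is the dual algebra of the path coalgebra. -/
noncomputable def completePathAlgebraEquiv :
    CompletePathAlgebra k V ≃ₐ[k] WithConv (PathCoalgebra k V →ₗ[k] k) :=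
  AlgEquiv.ofBijective (restrictDual (CoalgHom.id k (PathCoalgebra k V))) ⟨fun a b h => by
      ext p
      refine (pairing_ofPath a p).symm.trans (Eq.trans ?_ (pairing_ofPath b p))
      exact congrArg (fun f : WithConv (PathCoalgebra k V →ₗ[k] k) =>
        f (PathCoalgebra.ofPath k p)) h,
    restrictDual_surjective Function.injective_id⟩

lemma completePathAlgebraEquiv_apply (a : CompletePathAlgebra k V) (x : PathCoalgebra k V) :
    completePathAlgebraEquiv k V a x = pairing k V a x := rfl

variable [Finite V] [∀ a b : V, Finite (a ⟶ b)]

variable (k V) in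
/-- The isomorphism `Aut(kQ^c) ≃ Aut(kQ^a^)` sending `σ` to the adjoint of `σ⁻¹`. -/
noncomputable def pathAlgebraAutEquiv : (PathCoalgebra k V ≃ₗc[k] PathCoalgebra k V) ≃*
    (CompletePathAlgebra k V ≃ₐ[k] CompletePathAlgebra k V) :=
  -- Inversion identifies the group with its opposite; the second opposite, from the
  -- anti-isomorphism, cancels the first.
  (MulEquiv.inv' _).trans <|
    (MulEquiv.op (dualAutEquiv (ι := CoalgHom.id k (PathCoalgebra k V)) Function.injective_id
      fun _ => ⟨_, rfl⟩)).trans <|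
    (MulEquiv.opOp _).symm.trans (AlgEquiv.autCongr (completePathAlgebraEquiv k V).symm)

lemma pairing_pathAlgebraAutEquiv (σ : PathCoalgebra k V ≃ₗc[k] PathCoalgebra k V)
    (a : CompletePathAlgebra k V) (x : PathCoalgebra k V) :
    pairing k V (pathAlgebraAutEquiv k V σ a) x = pairing k V a (σ⁻¹ x) := by
  change pairing k V ((completePathAlgebraEquiv k V).symm
    ((dualAut σ⁻¹).unop (completePathAlgebraEquiv k V a))) x = _
  rw [← completePathAlgebraEquiv_apply, AlgEquiv.apply_symm_apply, dualAut_apply,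
    completePathAlgebraEquiv_apply]

end PathAlgebra

/-! ### Cutting decompositions of paths -/

section SumsOverDecompositions

variable {V : Type u} [Quiver.{v} V]

namespace Decomposition

/-- The decomposition of a trivial path. -/
def empty (a : V) : Decomposition a a := .nil

/-- Append a piece to a decomposition. -/
def snoc {a b c : V} (d : Decomposition a b) (q : {p : Path b c // 0 < p.length}) :
    Decomposition a c := .cons d q

/-- The number of pieces. -/
def size {a b : V} (d : Decomposition a b) : ℕ := Path.length (V := Pieces V) d

/-- The list of all ways of splitting a decomposition into two. -/
def splits {a b : V} (d : Decomposition a b) : List (Σ c : V, Decomposition a c × Decomposition c b) :=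
  QuiverCoalgebra.splits (V := Pieces V) d

@[elab_as_elim] lemma induction {a : V} {motive : ∀ {b : V}, Decomposition a b → Prop}
    (empty : motive (empty a))
    (snoc : ∀ {b c : V} (d : Decomposition a b) (q : {p : Path b c // 0 < p.length}),
      motive d → motive (d.snoc q)) : ∀ {b : V} (d : Decomposition a b), motive d
  | _, .nil => empty
  | _, .cons d q => snoc d q (induction empty snoc d)

@[simp] lemma size_empty (a : V) : (empty a).size = 0 := rfl

@[simp] lemma size_snoc {a b c : V} (d : Decomposition a b) (q : {p : Path b c // 0 < p.length}) :
    (d.snoc q).size = d.size + 1 := rfl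

@[simp] lemma splits_empty (a : V) : (empty a).splits = [⟨a, empty a, empty a⟩] := rfl

@[simp] lemma splits_snoc {a b c : V} (d : Decomposition a b)
    (q : {p : Path b c // 0 < p.length}) :
    (d.snoc q).splits = d.splits.map (fun s => ⟨s.1, s.2.1, s.2.2.snoc q⟩) ++
      [⟨c, d.snoc q, empty c⟩] := rfl

@[simp] lemma comp_empty (a : V) : (empty a).comp = .nil := rfl

@[simp] lemma comp_snoc {a b c : V} (d : Decomposition a b) (q : {p : Path b c // 0 < p.length}) :
    (d.snoc q).comp = d.comp.comp q.1 := rfl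

@[simp] lemma extendLast_empty {a c : V} (α : a ⟶ c) : (empty a).extendLast α = [] := rfl

@[simp] lemma extendLast_snoc {a b c e : V} (d : Decomposition a b)
    (q : {p : Path b c // 0 < p.length}) (α : c ⟶ e) :
    (d.snoc q).extendLast α = [d.snoc ⟨q.1.cons α, Nat.succ_pos _⟩] := rfl

/-- The decompositions of `pα` which arise from a decomposition of `p`. -/
def extensions {a b c : V} (α : b ⟶ c) (d : Decomposition a b) : List (Decomposition a c) :=
  d.snoc ⟨α.toPath, Nat.one_pos⟩ :: d.extendLast α

/-- A cut of an extension of `d` either lies at the very end, or leaves `α` on the right; the latter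
arise by cutting `d` first and extending the second part. This drives the induction in
`sum_decompositions_splits`. -/
lemma sum_splits_extensions {M : Type*} [AddCommMonoid M] {a b c : V} (α : b ⟶ c)
    (d : Decomposition a b) (h : ∀ x : V, Decomposition a x → Decomposition x c → M) :
    ((d.extensions α).map fun e => (e.splits.map fun s => h s.1 s.2.1 s.2.2).sum).sum =
      (d.splits.map fun s => ((s.2.2.extensions α).map (h s.1 s.2.1)).sum).sum +
        ((d.extensions α).map fun e => h c e (empty c)).sum := by
  induction d using Decomposition.induction with
  | empty => simp [extensions]
  | snoc d q _ =>
    simp only [extensions, extendLast_snoc, splits_snoc, List.map_append,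
      List.map_map, List.sum_append, Function.comp_def, List.map_cons, List.map_nil, List.sum_cons,
      List.sum_nil, add_zero, List.sum_map_add, extendLast_empty]
    abel

lemma sum_splits_right {M : Type*} [AddCommMonoid M] {a b : V} (d : Decomposition a b)
    (h : ∀ x : V, Decomposition a x → M) :
    (d.splits.map fun s => if s.2.2.size = 0 then h s.1 s.2.1 else 0).sum = h b d := by
  induction d using Decomposition.induction with
  | empty => simp
  | snoc d q _ => simp [List.map_map, Function.comp_def]

end Decomposition

open Decomposition

lemma decompositions_nil (a : V) : decompositions (.nil : Path a a) = [empty a] := rfl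

lemma decompositions_cons {a b c : V} (p : Path a b) (α : b ⟶ c) :
    decompositions (p.cons α) = (decompositions p).flatMap (extensions α) := rfl

lemma sum_decompositions_cons {M : Type*} [AddCommMonoid M] {a b c : V} (p : Path a b)
    (α : b ⟶ c) (h : Decomposition a c → M) :
    ((decompositions (p.cons α)).map h).sum =
      ((decompositions p).map fun d => ((d.extensions α).map h).sum).sum := by
  rw [decompositions_cons, List.map_flatMap, List.flatMap_def, List.sum_flatten, List.map_map]
  rfl

/-- Splitting a decomposition of a path amounts to splitting the path and decomposing both parts. -/
lemma sum_decompositions_splits {M : Type*} [AddCommMonoid M] {a b : V} (p : Path a b)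
    (h : ∀ x : V, Decomposition a x → Decomposition x b → M) :
    ((decompositions p).map fun d => (d.splits.map fun s => h s.1 s.2.1 s.2.2).sum).sum =
      ((splits p).map fun s => ((decompositions s.2.1).map fun d =>
        ((decompositions s.2.2).map fun e => h s.1 d e).sum).sum).sum := by
  induction p with
  | nil => simp [decompositions_nil, splits]
  | cons p α ih =>
    rw [sum_decompositions_cons]
    simp only [sum_splits_extensions, List.sum_map_add]
    rw [ih fun x d e => ((e.extensions α).map (h x d)).sum]
    simp only [splits, List.map_append, List.map_map, List.sum_append, Function.comp_def,
      sum_decompositions_cons, List.map_cons, List.map_nil, List.sum_cons,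
      List.sum_nil, add_zero, decompositions_nil]

end SumsOverDecompositions

/-! ### Right multiplication by arrows -/

section AppendArrow

variable {k : Type w} [Field k] {W : Type u} [Quiver.{v} W]

variable (k) in
/-- The basis element given by a trivial path. -/
noncomputable abbrev vertexElem (i : W) : PathCoalgebra k W :=
  PathCoalgebra.ofPath k (mkPath (.nil : Path i i))

lemma comul_vertexElem (i : W) :
    Coalgebra.comul (R := k) (vertexElem k i) = vertexElem k i ⊗ₜ[k] vertexElem k i := by
  simp [comul_ofPath, AnyPath.splits, splits]

lemma counit_vertexElem (i : W) : Coalgebra.counit (R := k) (vertexElem k i) = 1 := by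
  simp [counit_ofPath]

open Classical in
variable (k) in
/-- Right multiplication by an arrow. -/
noncomputable def appendArrow {b c : W} (α : b ⟶ c) : PathCoalgebra k W →ₗ[k] PathCoalgebra k W :=
  PathCoalgebra.lift k fun p =>
    if h : p.tgt = b then PathCoalgebra.ofPath k (mkPath ((p.path.cast rfl h).cons α)) else 0

lemma appendArrow_ofPath {a b c : W} (p : Path a b) (α : b ⟶ c) :
    appendArrow k α (PathCoalgebra.ofPath k (mkPath p)) =
      PathCoalgebra.ofPath k (mkPath (p.cons α)) := by
  simp [appendArrow]

lemma appendArrow_of_ne {b c : W} {p : AnyPath W} (h : p.tgt ≠ b) (α : b ⟶ c) :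
    appendArrow k α (PathCoalgebra.ofPath k p) = 0 := by
  simp [appendArrow, h]

lemma counit_appendArrow {b c : W} (α : b ⟶ c) (x : PathCoalgebra k W) :
    Coalgebra.counit (R := k) (appendArrow k α x) = 0 := by
  have : Coalgebra.counit (R := k) ∘ₗ appendArrow k α = 0 := by
    refine PathCoalgebra.hom_ext fun ⟨a, b', p⟩ => ?_
    by_cases h : b' = b
    · subst h
      simp [appendArrow_ofPath, counit_ofPath]
    · simp [appendArrow_of_ne (k := k) (p := ⟨a, b', p⟩) h]
  exact LinearMap.congr_fun this x

/-- A cut of `pα` either comes from a cut of `p`, with `α` on the right, or is the cut at the end.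
-/
lemma comul_appendArrow {b c : W} (α : b ⟶ c) (x : PathCoalgebra k W) :
    Coalgebra.comul (R := k) (appendArrow k α x) =
      (appendArrow k α).lTensor _ (Coalgebra.comul x) + appendArrow k α x ⊗ₜ[k] vertexElem k c := by
  have : Coalgebra.comul (R := k) ∘ₗ appendArrow k α =
      (appendArrow k α).lTensor _ ∘ₗ Coalgebra.comul +
        (TensorProduct.mk k _ _).flip (vertexElem k c) ∘ₗ appendArrow k α := by
    refine PathCoalgebra.hom_ext fun ⟨a, b', p⟩ => ?_
    by_cases h : b' = b
    · subst h
      simp [appendArrow_ofPath, comul_ofPath, AnyPath.splits, splits, List.map_map,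
        Function.comp_def, map_list_sum]
    · simp only [LinearMap.comp_apply, LinearMap.add_apply,
        appendArrow_of_ne (k := k) (p := ⟨a, b', p⟩) h, map_zero, comul_ofPath, map_list_sum,
        List.map_map, add_zero, AnyPath.splits]
      refine (List.sum_eq_zero fun y hy => ?_).symm
      obtain ⟨s, -, rfl⟩ := List.mem_map.1 hy
      simp [appendArrow_of_ne (k := k) (p := mkPath s.2.2) h]
  exact LinearMap.congr_fun this x

/-- The coefficients of the arrows from `s` to `t`. -/
noncomputable def arrowCoeffs (s t : W) (x : PathCoalgebra k W) : (s ⟶ t) →₀ k :=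
  Finsupp.comapDomain (fun α : s ⟶ t => (mkPath α.toPath : AnyPath W)) x
    (toPath_injective s t).injOn

/-- Right multiplication by the arrow part of an element of `P_{e_s, e_t}`. -/
noncomputable def appendArrows (s t : W) (x : PathCoalgebra k W) :
    PathCoalgebra k W →ₗ[k] PathCoalgebra k W :=
  Finsupp.linearCombination k (fun α : s ⟶ t => appendArrow k α) (arrowCoeffs s t x)

lemma appendArrows_apply (s t : W) (x y : PathCoalgebra k W) :
    appendArrows s t x y =
      Finsupp.linearCombination k (fun α : s ⟶ t => appendArrow k α y) (arrowCoeffs s t x) := by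
  simp [appendArrows, Finsupp.linearCombination_apply, Finsupp.sum]

lemma counit_appendArrows (s t : W) (x y : PathCoalgebra k W) :
    Coalgebra.counit (R := k) (appendArrows s t x y) = 0 := by
  rw [appendArrows_apply, Finsupp.linearCombination_apply, Finsupp.sum, map_sum]
  simp [counit_appendArrow]

lemma comul_appendArrows (s t : W) (x y : PathCoalgebra k W) :
    Coalgebra.comul (R := k) (appendArrows s t x y) =
      (appendArrows s t x).lTensor _ (Coalgebra.comul y) +
        appendArrows s t x y ⊗ₜ[k] vertexElem k t := by
  rw [appendArrows]
  induction arrowCoeffs s t x using Finsupp.induction_linear with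
  | zero => simp
  | add f g hf hg =>
    simp only [map_add, LinearMap.add_apply, hf, hg, LinearMap.lTensor_add, TensorProduct.add_tmul]
    abel
  | single α c =>
    simp only [Finsupp.linearCombination_single, LinearMap.smul_apply, map_smul, comul_appendArrow,
      LinearMap.lTensor_smul, TensorProduct.smul_tmul', smul_add]

open Classical in
/-- The coefficient of the new arrow. -/
noncomputable def newCoeff (s t : W) (x : PathCoalgebra k W) : k :=
  if s = t then 0 else x.coeff (mkPath (.nil : Path s s))

lemma newCoeff_of_eq {s t : W} (h : s = t) (x : PathCoalgebra k W) : newCoeff s t x = 0 := if_pos h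

lemma newCoeff_of_ne {s t : W} (h : s ≠ t) (x : PathCoalgebra k W) :
    newCoeff s t x = coeffForm k (mkPath (.nil : Path s s)) x := if_neg h

/-- The new arrow exists only for `s ≠ t`. Passing its value as `y` avoids a case distinction later:
for `s = t` the coefficient is `0` and `y` is irrelevant. -/
lemma linearCombination_toAugArrows {M : Type*} [AddCommGroup M] [Module k M] {s t : W}
    (x : PathCoalgebra k W) (G : AugArrow s t → M) (y : M) (hy : ∀ h, G (.new h) = y) :
    Finsupp.linearCombination k G (toAugArrows s t x) =
      Finsupp.linearCombination k (fun α => G (.old α)) (arrowCoeffs s t x) +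
        newCoeff s t x • y := by
  rw [toAugArrows, map_add, Finsupp.linearCombination_mapDomain]
  congr 1
  by_cases h : s = t
  · rw [dif_pos h, newCoeff_of_eq h, map_zero, zero_smul]
  · rw [dif_neg h, newCoeff, if_neg h, Finsupp.linearCombination_single, hy]

end AppendArrow

/-! ### Recursion for `F` on the last arrow -/

section Augmented

variable {k : Type w} [Field k] {W : Type u} [Quiver.{v} W]

variable (k) in
/-- The coefficient `y` in `F(qα) = yα`, for `q` a path of the augmented quiver and `α` an arrow of
the original quiver. -/
noncomputable def augTail {a b : W} (q : AugPath a b) : PathCoalgebra k W :=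
  match oldPart q, newOldPart q with
  | some p, _ => PathCoalgebra.ofPath k (mkPath p)
  | none, some s => -PathCoalgebra.ofPath k (mkPath s.2)
  | none, none => 0

variable (k) in
/-- The correction term from a new arrow with target `b` after a path of length `n`. -/
noncomputable def newTerm (b : W) (n : ℕ) : PathCoalgebra k W :=
  if n = 0 then -vertexElem k b else 0

lemma newTerm_zero (b : W) : newTerm k b 0 = -vertexElem k b := rfl

lemma augTail_cons_old {a b c : W} (q : AugPath a b) (α : b ⟶ c) :
    augTail k (Path.cons q (AugArrow.old α) : AugPath a c) = appendArrow k α (augTail k q) := by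
  simp only [augTail, oldPart, newOldPart]
  cases oldPart q with
  | some p => simp [appendArrow_ofPath]
  | none =>
    cases newOldPart q with
    | some s => simp [appendArrow_ofPath]
    | none => simp

lemma augTail_cons_new {a b c : W} (q : AugPath a b) (h : b ≠ c) :
    augTail k (Path.cons q (AugArrow.new h) : AugPath a c) =
      newTerm k c (Path.length (V := Augmented W) q) := by
  simp only [augTail, oldPart, newOldPart, newTerm]
  by_cases hq : Path.length (V := Augmented W) q = 0 <;> simp [hq]

lemma augValue_cons_old {a b c : W} (q : AugPath a b) (α : b ⟶ c) :
    augValue k (Path.cons q (AugArrow.old α) : AugPath a c) = appendArrow k α (augTail k q) := by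
  simp only [augTail, augValue]
  cases oldPart q with
  | some p => simp [appendArrow_ofPath]
  | none =>
    cases newOldPart q with
    | some s => simp [appendArrow_ofPath]
    | none => simp

/-- A final new arrow does not change `F`, except after a trivial path, where `F(e_{b,c}) = e_b -
e_c`; hence the correction term. -/
lemma augValue_cons_new {a b c : W} (q : AugPath a b) (h : b ≠ c) :
    augValue k (Path.cons q (AugArrow.new h) : AugPath a c) =
      augValue k q + newTerm k c (Path.length (V := Augmented W) q) := by
  cases q with
  | nil => exact sub_eq_add_neg _ _
  | cons q β => exact (add_zero _).symm

end Augmented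

/-! ### Comultiplication and counit on the summands of `f_μ` -/

namespace TransDatum

variable {k : Type w} [Field k] {V : Type u₁} [Quiver.{v₁} V] {W : Type u₂} [Quiver.{v₂} W]
  (μ : TransDatum k V W)

lemma box_snoc {a b c : V} (d : Decomposition a c) (q : {p : Path c b // 0 < p.length}) :
    μ.box (d.snoc q) = (μ.box d).sum fun r x =>
      (toAugArrows (μ.vertex c) (μ.vertex b) (μ.plus ⟨mkPath q.1, q.2⟩)).sum fun β y =>
        Finsupp.single (Path.cons r β : AugPath (μ.vertex a) (μ.vertex b)) (x * y) := rfl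

lemma box_empty (a : V) : μ.box (Decomposition.empty a) = Finsupp.single .nil 1 := rfl

lemma linearCombination_box_snoc {M : Type*} [AddCommGroup M] [Module k M] {a b c : V}
    (d : Decomposition a c) (q : {p : Path c b // 0 < p.length})
    (G : AugPath (μ.vertex a) (μ.vertex b) → M) :
    Finsupp.linearCombination k G (μ.box (d.snoc q)) =
      Finsupp.linearCombination k (fun r : AugPath (μ.vertex a) (μ.vertex c) =>
        Finsupp.linearCombination k
          (fun β : AugArrow (μ.vertex c) (μ.vertex b) =>
            G (Path.cons r β : AugPath (μ.vertex a) (μ.vertex b)))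
          (toAugArrows (μ.vertex c) (μ.vertex b) (μ.plus ⟨mkPath q.1, q.2⟩))) (μ.box d) := by
  rw [box_snoc]
  simp only [map_finsuppSum, Finsupp.linearCombination_single]
  simp only [Finsupp.linearCombination_apply, Finsupp.smul_sum, mul_smul]

/-- The summand `F(μ_{p₁} □ ⋯ □ μ_{pᵣ})` of `f_μ(p₁ ⋯ pᵣ)`. -/
noncomputable def value {a b : V} (d : Decomposition a b) : PathCoalgebra k W :=
  Finsupp.linearCombination k (augValue k) (μ.box d)

/-- The coefficient `y` in `F(μ_{p₁} □ ⋯ □ μ_{pᵣ} α) = yα`. -/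
noncomputable def tail {a b : V} (d : Decomposition a b) : PathCoalgebra k W :=
  Finsupp.linearCombination k (augTail k) (μ.box d)

@[simp] lemma value_empty (a : V) :
    μ.value (Decomposition.empty a) = vertexElem k (μ.vertex a) := by
  rw [value, box_empty, Finsupp.linearCombination_single, one_smul]
  rfl

@[simp] lemma tail_empty (a : V) :
    μ.tail (Decomposition.empty a) = vertexElem k (μ.vertex a) := by
  rw [tail, box_empty, Finsupp.linearCombination_single, one_smul]
  rfl

/-- All paths in the product of `r` pieces have length `r`, so the correction appears only for the
empty decomposition. -/
lemma linearCombination_newTerm_box {a b : V} (c : W) (d : Decomposition a b) :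
    Finsupp.linearCombination k (fun r : AugPath (μ.vertex a) (μ.vertex b) =>
      newTerm k c (Path.length (V := Augmented W) r)) (μ.box d) = newTerm k c d.size := by
  induction d using Decomposition.induction with
  | empty =>
    rw [box_empty, Finsupp.linearCombination_single, one_smul]
    rfl
  | snoc d q _ =>
    rw [linearCombination_box_snoc]
    change Finsupp.linearCombination k (fun _ => Finsupp.linearCombination k
      (fun _ => (0 : PathCoalgebra k W)) _) _ = 0
    simp [Finsupp.linearCombination_apply]

/-- Right multiplication by the arrow part of `μ_q`. -/
noncomputable def appendPiece {b c : V} (q : {p : Path b c // 0 < p.length}) :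
    PathCoalgebra k W →ₗ[k] PathCoalgebra k W :=
  appendArrows (μ.vertex b) (μ.vertex c) (μ.plus ⟨mkPath q.1, q.2⟩)

/-- The coefficient of the new arrow in `μ_q`. -/
noncomputable def pieceCoeff {b c : V} (q : {p : Path b c // 0 < p.length}) : k :=
  newCoeff (μ.vertex b) (μ.vertex c) (μ.plus ⟨mkPath q.1, q.2⟩)

/-- The common source of the recursions for `tail` and `value`: `augTail` and `augValue` agree on
paths ending in an arrow of `Q` and differ only through `y`, their behaviour at a final new arrow.
-/
lemma linearCombination_box_snoc_of {a b c : V} (d : Decomposition a c)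
    (q : {p : Path c b // 0 < p.length})
    (G : AugPath (μ.vertex a) (μ.vertex b) → PathCoalgebra k W)
    (y : AugPath (μ.vertex a) (μ.vertex c) → PathCoalgebra k W)
    (hold : ∀ (r : AugPath (μ.vertex a) (μ.vertex c)) (α : μ.vertex c ⟶ μ.vertex b),
      G (Path.cons r (AugArrow.old α)) = appendArrow k α (augTail k r))
    (hnew : ∀ (r : AugPath (μ.vertex a) (μ.vertex c)) (h : μ.vertex c ≠ μ.vertex b),
      G (Path.cons r (AugArrow.new h)) = y r) :
    Finsupp.linearCombination k G (μ.box (d.snoc q)) =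
      μ.appendPiece q (μ.tail d) +
        μ.pieceCoeff q • Finsupp.linearCombination k y (μ.box d) := by
  rw [linearCombination_box_snoc]
  have h : ∀ r : AugPath (μ.vertex a) (μ.vertex c), Finsupp.linearCombination k
      (fun β : AugArrow (μ.vertex c) (μ.vertex b) =>
        G (Path.cons r β : AugPath (μ.vertex a) (μ.vertex b)))
      (toAugArrows (μ.vertex c) (μ.vertex b) (μ.plus ⟨mkPath q.1, q.2⟩)) =
      μ.appendPiece q (augTail k r) + μ.pieceCoeff q • y r := by
    intro r
    rw [linearCombination_toAugArrows _ _ (y r) (hnew r), appendPiece, appendArrows_apply,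
      pieceCoeff]
    simp only [hold]
  simp only [h]
  rw [tail]
  simp only [Finsupp.linearCombination_apply, Finsupp.sum, smul_add, Finset.sum_add_distrib,
    map_sum, map_smul, Finset.smul_sum, smul_comm (μ.pieceCoeff q)]

lemma tail_snoc {a b c : V} (d : Decomposition a c) (q : {p : Path c b // 0 < p.length}) :
    μ.tail (d.snoc q) =
      μ.appendPiece q (μ.tail d) + μ.pieceCoeff q • newTerm k (μ.vertex b) d.size := by
  rw [tail, linearCombination_box_snoc_of μ d q _ _
    (fun r α => augTail_cons_old r α) (fun r h => augTail_cons_new r h),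
    linearCombination_newTerm_box]

lemma value_snoc {a b c : V} (d : Decomposition a c) (q : {p : Path c b // 0 < p.length}) :
    μ.value (d.snoc q) = μ.tail (d.snoc q) + μ.pieceCoeff q • μ.value d := by
  rw [value, linearCombination_box_snoc_of μ d q _ _
    (fun r α => augValue_cons_old r α) (fun r h => augValue_cons_new r h), tail_snoc,
    ← linearCombination_newTerm_box μ _ d, value, add_assoc, ← smul_add]
  congr 2
  rw [add_comm (Finsupp.linearCombination k _ _)]
  simp only [Finsupp.linearCombination_apply, Finsupp.sum, smul_add, Finset.sum_add_distrib]

lemma comul_newTerm (b : W) (n : ℕ) :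
    Coalgebra.comul (R := k) (newTerm k b n) = newTerm k b n ⊗ₜ[k] vertexElem k b := by
  unfold newTerm
  split_ifs
  · rw [map_neg, comul_vertexElem, TensorProduct.neg_tmul]
  · simp

lemma sum_value_tmul_newTerm {a b : V} (c : W) (d : Decomposition a b) :
    (d.splits.map fun s => μ.value s.2.1 ⊗ₜ[k] newTerm k c s.2.2.size).sum =
      -(μ.value d ⊗ₜ[k] vertexElem k c) := by
  rw [← d.sum_splits_right fun x e => -(μ.value e ⊗ₜ[k] vertexElem k c)]
  refine congrArg _ (List.map_congr_left fun s _ => ?_)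
  unfold newTerm
  split_ifs
  · exact TensorProduct.tmul_neg _ _
  · exact TensorProduct.tmul_zero _ _

lemma sum_value_tmul_tail_snoc {a b c : V} (d : Decomposition a c)
    (q : {p : Path c b // 0 < p.length})
    (ih : Coalgebra.comul (R := k) (μ.tail d) =
      (d.splits.map fun s => μ.value s.2.1 ⊗ₜ[k] μ.tail s.2.2).sum) :
    (d.splits.map fun s => μ.value s.2.1 ⊗ₜ[k] μ.tail (s.2.2.snoc q)).sum =
      (μ.appendPiece q).lTensor _ (Coalgebra.comul (μ.tail d)) -
        μ.pieceCoeff q • (μ.value d ⊗ₜ[k] vertexElem k (μ.vertex b)) := by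
  have h := congrArg (μ.pieceCoeff q • ·) (μ.sum_value_tmul_newTerm (μ.vertex b) d)
  simp only [List.smul_sum, List.map_map, Function.comp_def, smul_neg] at h
  simp only [tail_snoc, TensorProduct.tmul_add, List.sum_map_add, ih, map_list_sum, List.map_map,
    Function.comp_def, LinearMap.lTensor_tmul, TensorProduct.tmul_smul, h]
  abel

/-- Left factors of a cut are complete, right factors await another arrow, hence `value` on the left
and `tail` on the right. In the inductive step the terms with `newTerm` survive only for the cut of
`d` with empty second part (`sum_value_tmul_newTerm`), and cancel the excess of `value` over `tail`
in the final cut. -/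
lemma comul_tail {a b : V} (d : Decomposition a b) :
    Coalgebra.comul (R := k) (μ.tail d) =
      (d.splits.map fun s => μ.value s.2.1 ⊗ₜ[k] μ.tail s.2.2).sum := by
  induction d using Decomposition.induction with
  | empty => simp [comul_vertexElem]
  | snoc d q ih =>
    simp only [Decomposition.splits_snoc, List.map_append, List.sum_append, List.map_map,
      Function.comp_def, sum_value_tmul_tail_snoc μ d q ih, List.map_cons, List.map_nil,
      List.sum_cons, List.sum_nil, add_zero, tail_empty, value_snoc]
    rw [tail_snoc, map_add, map_smul, comul_newTerm, appendPiece, comul_appendArrows]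
    simp only [TensorProduct.add_tmul, TensorProduct.smul_tmul']
    abel

lemma comul_value {a b : V} (d : Decomposition a b) :
    Coalgebra.comul (R := k) (μ.value d) =
      (d.splits.map fun s => μ.value s.2.1 ⊗ₜ[k] μ.value s.2.2).sum := by
  induction d using Decomposition.induction with
  | empty => simp [comul_vertexElem]
  | snoc d q ih =>
    have h1 := μ.comul_tail (d.snoc q)
    simp only [Decomposition.splits_snoc, List.map_append, List.sum_append, List.map_map,
      Function.comp_def, List.map_cons, List.map_nil,
      List.sum_cons, List.sum_nil, add_zero, tail_empty] at h1
    have h2 := congrArg (μ.pieceCoeff q • ·) ih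
    simp only [List.smul_sum, List.map_map, Function.comp_def] at h2
    rw [value_snoc, map_add, h1, map_smul, h2]
    simp only [Decomposition.splits_snoc, List.map_append, List.sum_append, List.map_map,
      Function.comp_def, List.map_cons, List.map_nil,
      List.sum_cons, List.sum_nil, add_zero, value_empty, value_snoc μ _ q, TensorProduct.tmul_add,
      List.sum_map_add, TensorProduct.tmul_smul]
    abel

/-- Appended arrows have counit `0`. A new arrow as the first piece contributes a multiple of a
difference of two vertices, on which the counit also vanishes. -/
lemma counit_value {a b : V} (d : Decomposition a b) :
    Coalgebra.counit (R := k) (μ.value d) = if d.size = 0 then 1 else 0 := by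
  induction d using Decomposition.induction with
  | empty => rw [value_empty, counit_vertexElem, if_pos (Decomposition.size_empty a)]
  | snoc d q ih =>
    rw [value_snoc, tail_snoc, appendPiece]
    simp only [map_add, map_smul, counit_appendArrows, ih, newTerm]
    by_cases h : d.size = 0 <;> simp [h, counit_vertexElem]

end TransDatum

/-! ### Primitive and group-like elements of the path coalgebra -/

section Primitive

variable {k : Type w} [Field k] {W : Type u} [Quiver.{v} W]

lemma vertexIncl_single (i : W) : vertexIncl k W (Finsupp.single i 1) = vertexElem k i := by
  simp [vertexIncl, vertexElem]

lemma vertexElem_injective : Function.Injective (vertexElem k : W → PathCoalgebra k W) := by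
  intro i j h
  by_contra hij
  have hne : (mkPath (.nil : Path j j) : AnyPath W) ≠ mkPath (.nil : Path i i) := fun h' =>
    hij (congrArg AnyPath.src h').symm
  have h1 := congrArg (coeffForm k (mkPath (.nil : Path i i))) h
  rw [coeffForm_self, coeffForm_of_ne hne] at h1
  exact one_ne_zero h1

lemma coeffForm_vertexElem_cons {a b c : W} (p : Path a b) (α : b ⟶ c) (i : W) :
    coeffForm k (mkPath (p.cons α)) (vertexElem k i) = 0 := by
  refine coeffForm_of_ne fun h => ?_
  simpa using congrArg (fun r : AnyPath W => r.path.length) h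

lemma coeffForm_appendArrows_vertexElem (s t : W) (x : PathCoalgebra k W) (p : AnyPath W) :
    coeffForm k p (appendArrows s t x (vertexElem k s)) =
      Finsupp.mapDomain (fun α : s ⟶ t => (mkPath α.toPath : AnyPath W)) (arrowCoeffs s t x) p := by
  rw [appendArrows_apply]
  induction arrowCoeffs s t x using Finsupp.induction_linear with
  | zero => simp
  | add f g hf hg => rw [map_add, map_add, hf, hg, Finsupp.mapDomain_add, Finsupp.add_apply]
  | single α c =>
    rw [Finsupp.linearCombination_single, Finsupp.mapDomain_single, map_smul]
    change c • coeffForm k p (appendArrow k α (PathCoalgebra.ofPath k (mkPath .nil))) = _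
    rw [appendArrow_ofPath]
    by_cases h : (mkPath α.toPath : AnyPath W) = p
    · subst h
      rw [Finsupp.single_eq_same]
      exact (congrArg _ (coeffForm_self _)).trans (mul_one c)
    · rw [Finsupp.single_eq_of_ne' h]
      exact (congrArg _ (coeffForm_of_ne h)).trans (mul_zero c)

lemma coeffForm_appendArrows_arrow {s t : W} (x : PathCoalgebra k W) (α : s ⟶ t) :
    coeffForm k (mkPath α.toPath) (appendArrows s t x (vertexElem k s)) =
      coeffForm k (mkPath α.toPath) x := by
  rw [coeffForm_appendArrows_vertexElem]
  exact Finsupp.mapDomain_apply (toPath_injective s t) _ α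

lemma coeffForm_appendArrows_of_forall_ne {s t : W} (x : PathCoalgebra k W) {p : AnyPath W}
    (h : ∀ α : s ⟶ t, mkPath α.toPath ≠ p) :
    coeffForm k p (appendArrows s t x (vertexElem k s)) = 0 := by
  rw [coeffForm_appendArrows_vertexElem]
  exact Finsupp.mapDomain_of_notMem_range _ _ fun ⟨α, hα⟩ => h α hα

open Classical in
/-- The elements of `P_{e_s, e_t}` are the combinations of arrows from `s` to `t` and of
`e_s - e_t`. -/
lemma appendArrows_add_newCoeff {s t : W} {x : PathCoalgebra k W}
    (hx : x ∈ primitiveElements k (vertexElem k s) (vertexElem k t)) :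
    appendArrows s t x (vertexElem k s) + newCoeff s t x • (vertexElem k s - vertexElem k t) =
      x := by
  have hx : Coalgebra.comul (R := k) x = vertexElem k s ⊗ₜ[k] x + x ⊗ₜ[k] vertexElem k t := hx
  have key : ∀ p q : AnyPath W,
      tensorForm (coeffForm k p) (coeffForm k q) (Coalgebra.comul (R := k) x) =
        (if mkPath (.nil : Path s s) = p then 1 else 0) * coeffForm k q x +
          coeffForm k p x * (if mkPath (.nil : Path t t) = q then 1 else 0) := by
    intro p q
    rw [hx, map_add, tensorForm_tmul, tensorForm_tmul, coeffForm_ofPath, coeffForm_ofPath]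
  have hnil : ∀ i j : W, (mkPath (.nil : Path i i) : AnyPath W) = mkPath (.nil : Path j j) ↔
      i = j := fun i j => ⟨fun h => congrArg AnyPath.src h, fun h => by rw [h]⟩
  have hcons : ∀ {a b c : W} (i : W) (p : Path a b) (α : b ⟶ c),
      (mkPath (.nil : Path i i) : AnyPath W) ≠ mkPath (p.cons α) := fun i p α h => by
    simpa using congrArg (fun r : AnyPath W => r.path.length) h
  refine ext_coeffForm fun ⟨a, c, p⟩ => ?_
  rw [map_add, map_smul, map_sub, smul_eq_mul]
  cases p with
  | nil =>
    rw [coeffForm_appendArrows_of_forall_ne x fun α h => hcons a .nil α h.symm, zero_add,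
      coeffForm_ofPath, coeffForm_ofPath, hnil, hnil]
    have h1 := key (mkPath (.nil : Path a a)) (mkPath (.nil : Path a a))
    rw [tensorForm_comul_comp, hnil, hnil, Path.comp_nil] at h1
    by_cases hst : s = t
    · subst hst
      rw [newCoeff_of_eq rfl, zero_mul]
      by_cases hs : s = a
      · simp only [hs, if_true, one_mul, mul_one] at h1
        -- For `s = t` the coefficient `c` of this vertex satisfies `c = c + c`.
        exact (left_eq_add.1 h1).symm
      · simpa [hs] using h1.symm
    · rw [newCoeff_of_ne hst]
      by_cases hs : s = a
      · subst hs
        simp [Ne.symm hst]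
      · by_cases ht : t = a
        · subst ht
          -- As `s ≠ t`, the tensor `e_s ⊗ e_t` does not occur in any `Δ(x)`; so the coefficients of
          -- `e_s` and `e_t` are opposite.
          have h2 := key (mkPath (.nil : Path s s)) (mkPath (.nil : Path t t))
          rw [tensorForm_comul_of_ne hst] at h2
          simp only [if_true, one_mul, mul_one] at h2
          simp only [hst, if_false, if_true, zero_sub, mul_neg, mul_one]
          exact neg_eq_of_add_eq_zero_left h2.symm
        · simpa [hs, ht] using h1.symm
  | cons p α =>
    rw [coeffForm_vertexElem_cons, coeffForm_vertexElem_cons, sub_zero, mul_zero, add_zero]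
    cases p with
    | nil =>
      have hα : ∀ i : W, (mkPath (.nil : Path i i) : AnyPath W) ≠ mkPath α.toPath :=
        fun i => hcons i .nil α
      have h1 := key (mkPath (.nil : Path a a)) (mkPath α.toPath)
      have h2 := key (mkPath α.toPath) (mkPath (.nil : Path c c))
      rw [tensorForm_comul_comp, hnil, if_neg (hα t), Path.nil_comp] at h1
      rw [tensorForm_comul_comp, hnil, if_neg (hα s), Path.comp_nil] at h2
      by_cases hs : s = a
      · by_cases ht : t = c
        · subst hs ht
          exact coeffForm_appendArrows_arrow x α
        · rw [if_neg ht, zero_mul, mul_zero, add_zero] at h2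
          refine Eq.trans (coeffForm_appendArrows_of_forall_ne x fun β h => ht ?_) h2.symm
          exact congrArg AnyPath.tgt h
      · rw [if_neg hs, zero_mul, mul_zero, add_zero] at h1
        refine Eq.trans (coeffForm_appendArrows_of_forall_ne x fun β h => hs ?_) h1.symm
        exact congrArg AnyPath.src h
    | cons p β =>
      have hα : (mkPath (.nil : Path t t) : AnyPath W) ≠ mkPath α.toPath := hcons t .nil α
      -- A path of length at least two has a splitting without trivial factors, which forces its
      -- coefficient to vanish.
      have h1 := key (mkPath (p.cons β)) (mkPath α.toPath)
      rw [tensorForm_comul_comp, if_neg (hcons s p β), if_neg hα, zero_mul, mul_zero,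
        add_zero] at h1
      refine Eq.trans (coeffForm_appendArrows_of_forall_ne x fun γ h => ?_) h1.symm
      simpa using congrArg (fun r : AnyPath W => r.path.length) h

/-- The group-like elements of the path coalgebra are the trivial paths. -/
lemma exists_eq_vertexElem {g : PathCoalgebra k W}
    (hg : Coalgebra.comul (R := k) g = g ⊗ₜ[k] g) (hg1 : Coalgebra.counit (R := k) g = 1) :
    ∃ i, g = vertexElem k i := by
  classical
  have key : ∀ p q : AnyPath W,
      tensorForm (coeffForm k p) (coeffForm k q) (Coalgebra.comul (R := k) g) =
        coeffForm k p g * coeffForm k q g := by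
    intro p q
    rw [hg, tensorForm_tmul]
  -- If a nontrivial path `q` has nonzero coefficient, so has `q ⊗ q` in `Δ(g)`. Thus `q` is a cycle
  -- and `q²` has nonzero coefficient; repeated doubling contradicts finite support.
  have hcycle : ∀ (n : ℕ) (p : AnyPath W), coeffForm k p g ≠ 0 → 0 < p.path.length →
      ∃ q : AnyPath W, coeffForm k q g ≠ 0 ∧ n < q.path.length := by
    intro n
    induction n with
    | zero => exact fun p h h0 => ⟨p, h, h0⟩
    | succ n ih =>
      intro p h h0
      obtain ⟨⟨a, b, q⟩, hq, hn⟩ := ih p h h0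
      have h1 := key ⟨a, b, q⟩ ⟨a, b, q⟩
      by_cases hab : b = a
      · subst hab
        rw [tensorForm_comul_comp] at h1
        refine ⟨mkPath (q.comp q), h1 ▸ mul_ne_zero hq hq, ?_⟩
        simp only [Path.length_comp] at hn ⊢
        omega
      · rw [tensorForm_comul_of_ne hab] at h1
        exact absurd h1.symm (mul_ne_zero hq hq)
  have hpos : ∀ p : AnyPath W, 0 < p.path.length → coeffForm k p g = 0 := by
    intro p hp
    by_contra h
    obtain ⟨n, hn⟩ := exists_length_lt g
    obtain ⟨q, hq, hq'⟩ := hcycle n p h hp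
    exact absurd (hn q hq) (by omega)
  have hex : ∃ i : W, coeffForm k (mkPath (.nil : Path i i)) g ≠ 0 := by
    by_contra! h
    have : g = 0 := ext_coeffForm fun ⟨a, b, p⟩ => by
      cases p with
      | nil => rw [h, map_zero]
      | cons p α => rw [hpos _ (by simp), map_zero]
    rw [this, map_zero] at hg1
    exact zero_ne_one hg1
  obtain ⟨i, hi⟩ := hex
  refine ⟨i, ext_coeffForm fun ⟨a, b, p⟩ => ?_⟩
  cases p with
  | cons p α => rw [coeffForm_vertexElem_cons, hpos _ (by simp)]
  | nil =>
    rw [coeffForm_ofPath]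
    by_cases hia : i = a
    · subst hia
      rw [if_pos rfl]
      have h1 := key (mkPath (.nil : Path i i)) (mkPath (.nil : Path i i))
      rw [tensorForm_comul_comp, Path.comp_nil] at h1
      exact (left_eq_mul₀ hi).1 h1
    · rw [if_neg fun h => hia (congrArg AnyPath.src h)]
      have h1 := key (mkPath (.nil : Path i i)) (mkPath (.nil : Path a a))
      rw [tensorForm_comul_of_ne hia] at h1
      exact (mul_eq_zero.1 h1.symm).resolve_left hi

end Primitive

/-! ### The map `μ ↦ f_μ`: coalgebra homomorphisms and uniqueness -/

namespace TransDatum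

variable {k : Type w} [Field k] {V : Type u₁} [Quiver.{v₁} V] {W : Type u₂} [Quiver.{v₂} W]
  (μ ν : TransDatum k V W)

lemma toLinearMap_ofPath {a b : V} (p : Path a b) :
    μ.toLinearMap (PathCoalgebra.ofPath k (mkPath p)) = ((decompositions p).map μ.value).sum :=
  PathCoalgebra.lift_ofPath k _ _

lemma toLinearMap_vertexElem (i : V) :
    μ.toLinearMap (vertexElem k i) = vertexElem k (μ.vertex i) := by
  rw [toLinearMap_ofPath, decompositions_nil]
  simp

lemma comul_toLinearMap : Coalgebra.comul ∘ₗ μ.toLinearMap =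
    TensorProduct.map μ.toLinearMap μ.toLinearMap ∘ₗ Coalgebra.comul (R := k) := by
  refine PathCoalgebra.hom_ext fun ⟨a, b, p⟩ => ?_
  rw [LinearMap.comp_apply, LinearMap.comp_apply, toLinearMap_ofPath, comul_ofPath, map_list_sum,
    map_list_sum, List.map_map, List.map_map]
  simp only [Function.comp_def, comul_value]
  rw [sum_decompositions_splits p fun x d e => μ.value d ⊗ₜ[k] μ.value e]
  simp only [AnyPath.splits, List.map_map, Function.comp_def, TensorProduct.map_tmul,
    toLinearMap_ofPath, sum_tmul_list]
  simp only [tmul_sum_list, List.map_map, Function.comp_def]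

lemma counit_toLinearMap : Coalgebra.counit ∘ₗ μ.toLinearMap = Coalgebra.counit (R := k) := by
  refine PathCoalgebra.hom_ext fun ⟨a, b, p⟩ => ?_
  rw [LinearMap.comp_apply, counit_ofPath]
  cases p with
  | nil => rw [toLinearMap_vertexElem, counit_vertexElem]; rfl
  | cons p α =>
    rw [toLinearMap_ofPath, sum_decompositions_cons, map_list_sum, List.map_map, List.sum_eq_zero]
    · simp
    · intro y hy
      obtain ⟨d, -, rfl⟩ := List.mem_map.1 hy
      rw [Function.comp_apply, map_list_sum, List.map_map]
      induction d using Decomposition.induction with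
      | empty => simp [Decomposition.extensions, counit_value]
      | snoc d q _ => simp [Decomposition.extensions, counit_value]

/-- The coalgebra homomorphism `f_μ`. -/
noncomputable def toCoalgHom : PathCoalgebra k V →ₗc[k] PathCoalgebra k W where
  toLinearMap := μ.toLinearMap
  counit_comp := μ.counit_toLinearMap
  map_comp_comul := μ.comul_toLinearMap.symm

lemma plus_mem' {a b : V} (q : {p : Path a b // 0 < p.length}) :
    μ.plus ⟨mkPath q.1, q.2⟩ ∈
      primitiveElements k (vertexElem k (μ.vertex a)) (vertexElem k (μ.vertex b)) := by
  have := μ.plus_mem ⟨mkPath q.1, q.2⟩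
  rwa [zero_single, zero_single, vertexIncl_single, vertexIncl_single] at this

/-- `F` inverts the identification of primitive elements with arrows of the augmented quiver, so the
summand of `f_μ(p)` with `r = 1` is `μ_p` itself. -/
lemma value_snoc_empty {a b : V} (q : {p : Path a b // 0 < p.length}) :
    μ.value ((Decomposition.empty a).snoc q) = μ.plus ⟨mkPath q.1, q.2⟩ := by
  rw [value_snoc, tail_snoc, value_empty, tail_empty, Decomposition.size_empty, newTerm_zero,
    add_assoc, ← smul_add, neg_add_eq_sub]
  exact appendArrows_add_newCoeff (μ.plus_mem' q)

/-- Two trans-data agree on the vertices and on the paths of length less than `n`. -/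
def AgreeBelow (n : ℕ) : Prop :=
  μ.zero = ν.zero ∧ ∀ p, p.1.path.length < n → μ.plus p = ν.plus p

variable {μ ν}

lemma vertex_congr (h : μ.zero = ν.zero) (i : V) : μ.vertex i = ν.vertex i := by
  have h1 := μ.zero_single i
  rw [h, ν.zero_single] at h1
  exact (Finsupp.single_left_injective one_ne_zero h1).symm

lemma AgreeBelow.tail_eq_and_value_eq {n : ℕ} (h : AgreeBelow μ ν n) {a b : V}
    (d : Decomposition a b) (hd : d.comp.length < n) :
    μ.tail d = ν.tail d ∧ μ.value d = ν.value d := by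
  induction d using Decomposition.induction with
  | empty => simp [vertex_congr h.1]
  | snoc d q ih =>
    rw [Decomposition.comp_snoc, Path.length_comp] at hd
    obtain ⟨h1, h2⟩ := ih (by omega)
    have hq : μ.plus ⟨mkPath q.1, q.2⟩ = ν.plus ⟨mkPath q.1, q.2⟩ :=
      h.2 _ (lt_of_le_of_lt (Nat.le_add_left _ _) hd)
    have h3 : μ.tail (d.snoc q) = ν.tail (d.snoc q) := by
      simp only [tail_snoc, appendPiece, pieceCoeff, vertex_congr h.1, hq, h1]
    refine ⟨h3, ?_⟩
    simp only [value_snoc, pieceCoeff, vertex_congr h.1, hq, h2, h3]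

/-- With two or more pieces, every piece is strictly shorter than the whole path. This is why length
`n` itself is allowed here. -/
lemma AgreeBelow.value_eq {n : ℕ} (h : AgreeBelow μ ν n) {a b : V}
    (d : Decomposition a b) (hd : d.comp.length ≤ n) (hsize : d.size ≠ 1) :
    μ.value d = ν.value d := by
  induction d using Decomposition.induction with
  | empty => simp [vertex_congr h.1]
  | snoc d q _ =>
    rw [Decomposition.comp_snoc, Path.length_comp] at hd
    have hq0 := q.2
    have hd0 : 0 < d.comp.length := by
      induction d using Decomposition.induction with
      | empty => exact absurd rfl hsize
      | snoc d q' _ =>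
        have := q'.2
        rw [Decomposition.comp_snoc, Path.length_comp]
        omega
    obtain ⟨h1, h2⟩ := h.tail_eq_and_value_eq d (by omega)
    have hq : μ.plus ⟨mkPath q.1, q.2⟩ = ν.plus ⟨mkPath q.1, q.2⟩ :=
      h.2 _ (show q.1.length < n by omega)
    simp only [value_snoc, tail_snoc, appendPiece, pieceCoeff, vertex_congr h.1, hq, h1, h2]

lemma _root_.QuiverCoalgebra.Decomposition.eq_of_size_eq_one {a b : V} (d : Decomposition a b)
    (hd : d.size = 1) (hpos : 0 < d.comp.length) :
    d = (Decomposition.empty a).snoc ⟨d.comp, hpos⟩ := by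
  induction d using Decomposition.induction with
  | empty => simp at hd
  | snoc d q _ =>
    induction d using Decomposition.induction with
    | empty =>
      congr 1
      exact Subtype.ext (Path.nil_comp _).symm
    | snoc d q' _ => simp at hd

/-- The first difference between `f_μ` and `f_ν` is the first difference between `μ` and `ν`. -/
lemma AgreeBelow.toLinearMap_sub {n : ℕ} (h : AgreeBelow μ ν n) (p : AnyPath V)
    (hp : 0 < p.path.length) (hn : p.path.length ≤ n) :
    μ.toLinearMap (PathCoalgebra.ofPath k p) - ν.toLinearMap (PathCoalgebra.ofPath k p) =
      μ.plus ⟨p, hp⟩ - ν.plus ⟨p, hp⟩ := by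
  classical
  obtain ⟨a, b, p⟩ := p
  rw [toLinearMap_ofPath, toLinearMap_ofPath, ← List.sum_toFinset _ (nodup_decompositions p),
    ← List.sum_toFinset _ (nodup_decompositions p), ← Finset.sum_sub_distrib,
    Finset.sum_eq_single ((Decomposition.empty a).snoc ⟨p, hp⟩)]
  · rw [value_snoc_empty, value_snoc_empty]
  · intro d hd hne
    rw [List.mem_toFinset, mem_decompositions] at hd
    rw [sub_eq_zero]
    refine h.value_eq d (by rw [hd]; exact hn) fun hsize => hne ?_
    subst hd
    exact d.eq_of_size_eq_one hsize hp
  · intro hnot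
    rw [List.mem_toFinset, mem_decompositions] at hnot
    exact absurd (Path.nil_comp p) hnot

lemma toLinearMap_eq_of_length_eq_zero (h : μ.zero = ν.zero) {p : AnyPath V}
    (hp : p.path.length = 0) : μ.toLinearMap (PathCoalgebra.ofPath k p) =
      ν.toLinearMap (PathCoalgebra.ofPath k p) := by
  obtain ⟨a, b, p⟩ := p
  cases p with
  | nil => rw [toLinearMap_vertexElem, toLinearMap_vertexElem, vertex_congr h]
  | cons p α => simp at hp

/-- At each new length `AgreeBelow.toLinearMap_sub` turns equality of the maps into equality of the
data, so the data are recovered length by length. -/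
lemma agreeBelow_of_toLinearMap_eq (h0 : μ.zero = ν.zero) (n : ℕ)
    (h : ∀ p : AnyPath V, p.path.length < n →
      μ.toLinearMap (PathCoalgebra.ofPath k p) = ν.toLinearMap (PathCoalgebra.ofPath k p)) :
    AgreeBelow μ ν n := by
  induction n with
  | zero => exact ⟨h0, fun p hp => absurd hp (Nat.not_lt_zero _)⟩
  | succ n ih =>
    have hn := ih fun p hp => h p (by omega)
    refine ⟨h0, fun p hp => ?_⟩
    rw [← sub_eq_zero, ← hn.toLinearMap_sub p.1 p.2 (by omega), h _ hp, sub_self]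

lemma AgreeBelow.toLinearMap_eq {n : ℕ} (h : AgreeBelow μ ν n) (p : AnyPath V)
    (hp : p.path.length < n) :
    μ.toLinearMap (PathCoalgebra.ofPath k p) = ν.toLinearMap (PathCoalgebra.ofPath k p) := by
  rcases Nat.eq_zero_or_pos p.path.length with h0 | h0
  · exact toLinearMap_eq_of_length_eq_zero h.1 h0
  · rw [← sub_eq_zero, h.toLinearMap_sub p h0 hp.le, h.2 ⟨p, h0⟩ hp, sub_self]

lemma zero_eq_of_vertex_eq (h : ∀ i, μ.vertex i = ν.vertex i) : μ.zero = ν.zero := by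
  have : (μ.zero : (V →₀ k) →ₗ[k] (W →₀ k)) = ν.zero := by
    refine Finsupp.lhom_ext' fun i => LinearMap.ext_ring ?_
    change μ.zero (Finsupp.single i 1) = ν.zero (Finsupp.single i 1)
    rw [zero_single, zero_single, h]
  exact CoalgHom.coe_linearMap_injective this

lemma toLinearMap_injective :
    Function.Injective (toLinearMap : TransDatum k V W → PathCoalgebra k V →ₗ[k] _) := by
  intro μ ν h
  have h0 : μ.zero = ν.zero := zero_eq_of_vertex_eq fun i => vertexElem_injective (k := k) <| by
    rw [← toLinearMap_vertexElem, ← toLinearMap_vertexElem, h]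
  refine TransDatum.ext h0 (funext fun p => ?_)
  exact (agreeBelow_of_toLinearMap_eq h0 (p.1.path.length + 1) fun q _ => by rw [h]).2 p
    (Nat.lt_succ_self _)

end TransDatum

/-- The difference of two coalgebra homomorphisms on the shortest paths on which they differ is
primitive. -/
lemma sub_mem_primitiveElements {k : Type w} [Field k] {V : Type u₁} [Quiver.{v₁} V] {C : Type*}
    [AddCommGroup C] [Module k C] [Coalgebra k C] (f g : PathCoalgebra k V →ₗc[k] C)
    (p : AnyPath V) (hp : 0 < p.path.length)
    (h : ∀ q : AnyPath V, q.path.length < p.path.length →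
      f (PathCoalgebra.ofPath k q) = g (PathCoalgebra.ofPath k q)) :
    f (PathCoalgebra.ofPath k p) - g (PathCoalgebra.ofPath k p) ∈
      primitiveElements k (f (vertexElem k p.src)) (f (vertexElem k p.tgt)) := by
  change Coalgebra.comul (R := k) _ = _
  set x := f (PathCoalgebra.ofPath k p) - g (PathCoalgebra.ofPath k p) with hx
  have hcomul : ∀ f : PathCoalgebra k V →ₗc[k] C,
      Coalgebra.comul (R := k) (f (PathCoalgebra.ofPath k p)) =
        (p.splits.map fun s =>
          f (PathCoalgebra.ofPath k s.1) ⊗ₜ[k] f (PathCoalgebra.ofPath k s.2)).sum := by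
    intro f
    rw [← CoalgHomClass.map_comp_comul_apply, comul_ofPath, map_list_sum, List.map_map]
    rfl
  have hl := p.splits_left fun q => f (vertexElem k p.src) ⊗ₜ[k]
    (f (PathCoalgebra.ofPath k q) - g (PathCoalgebra.ofPath k q))
  have hr := p.splits_right fun q =>
    (f (PathCoalgebra.ofPath k q) - g (PathCoalgebra.ofPath k q)) ⊗ₜ[k] f (vertexElem k p.tgt)
  rw [hx, map_sub, hcomul, hcomul, sub_eq_iff_eq_add, ← hl, ← hr, ← List.sum_map_add,
    ← List.sum_map_add]
  refine congrArg _ (List.map_congr_left fun s hs => ?_)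
  -- On a splitting with two nontrivial parts `f` and `g` agree on both, and the terms cancel. The
  -- two remaining splittings give the primitive terms, as `f` and `g` agree on vertices.
  obtain ⟨c, y, z, hyz, rfl⟩ := mem_anyPath_splits.1 hs
  have hlen : y.length + z.length = p.path.length := by rw [← hyz, Path.length_comp]
  cases y with
  | nil =>
    have hz : z.length ≠ 0 := by simp at hlen; omega
    simp only [Path.length_nil, if_true, if_neg hz, add_zero, TensorProduct.tmul_sub]
    rw [h (mkPath .nil) (by simpa using hp), sub_add_cancel]
  | cons y α =>
    cases z with
    | nil =>
      simp only [Path.length_nil, if_true, Path.length_cons, Nat.succ_ne_zero, if_false, zero_add,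
        TensorProduct.sub_tmul]
      rw [h (mkPath .nil) (by simpa using hp), sub_add_cancel]
    | cons z β =>
      simp only [Path.length_cons] at hlen
      simp only [Path.length_cons, Nat.add_eq_zero_iff, one_ne_zero, and_false, if_false, add_zero,
        zero_add]
      rw [h (mkPath (y.cons α)) (by simp only [Path.length_cons]; omega),
        h (mkPath (z.cons β)) (by simp only [Path.length_cons]; omega)]

/-! ### Every coalgebra homomorphism comes from a trans-datum -/

namespace TransDatum

variable {k : Type w} [Field k] {V : Type u₁} [Quiver.{v₁} V] {W : Type u₂} [Quiver.{v₂} W]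

variable (k) in
/-- The coalgebra homomorphism `kV₀ → kW₀` induced by a map of vertices. -/
noncomputable def vertexHom {X Y : Type*} (f : X → Y) : (X →₀ k) →ₗc[k] (Y →₀ k) where
  toLinearMap := Finsupp.lmapDomain k k f
  counit_comp := Finsupp.lhom_ext' fun i => LinearMap.ext_ring (by simp)
  map_comp_comul := Finsupp.lhom_ext' fun i => LinearMap.ext_ring (by simp)

lemma vertexHom_single {X Y : Type*} (f : X → Y) (i : X) :
    vertexHom k f (Finsupp.single i 1) = Finsupp.single (f i) 1 :=
  Finsupp.mapDomain_single

variable {f : PathCoalgebra k V →ₗc[k] PathCoalgebra k W} {w : V → W}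

lemma vertex_of_zero_eq {μ : TransDatum k V W} (h : μ.zero = vertexHom k w) (i : V) :
    μ.vertex i = w i := by
  have h1 := μ.zero_single i
  rw [h, vertexHom_single] at h1
  exact (Finsupp.single_left_injective one_ne_zero h1).symm

lemma exists_toLinearMap_eq_below (hw : ∀ i, f (vertexElem k i) = vertexElem k (w i)) (n : ℕ) :
    ∃ μ : TransDatum k V W, μ.zero = vertexHom k w ∧ ∀ p : AnyPath V, p.path.length ≤ n →
      μ.toLinearMap (PathCoalgebra.ofPath k p) = f (PathCoalgebra.ofPath k p) := by
  induction n with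
  | zero =>
    refine ⟨⟨vertexHom k w, 0, fun p => Submodule.zero_mem _⟩, rfl, ?_⟩
    rintro ⟨a, b, p⟩ hp
    cases p with
    | nil => rw [toLinearMap_vertexElem, vertex_of_zero_eq rfl, hw]
    | cons p α => simp at hp
  | succ n ih =>
    obtain ⟨μ, h0, hμ⟩ := ih
    -- The error of `f_μ` on paths of length `n + 1` is primitive, hence may be added to `μ_p`. This
    -- repairs length `n + 1` and leaves shorter paths untouched.
    let ν : TransDatum k V W :=
      { zero := μ.zero
        plus := fun p => if p.1.path.length = n + 1 then
          μ.plus p + (f (PathCoalgebra.ofPath k p.1) - μ.toLinearMap (PathCoalgebra.ofPath k p.1))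
          else μ.plus p
        plus_mem := by
          rintro ⟨p, hp⟩
          split_ifs with h
          · refine Submodule.add_mem _ (μ.plus_mem _) ?_
            have h1 := sub_mem_primitiveElements f μ.toCoalgHom p hp fun q hq =>
              (hμ q (by dsimp only at h; omega)).symm
            rwa [hw, hw, ← vertexIncl_single, ← vertexIncl_single, ← vertexHom_single w,
              ← vertexHom_single w, ← h0] at h1
          · exact μ.plus_mem _ }
    have hagree : AgreeBelow ν μ (n + 1) := ⟨rfl, fun p hp => if_neg hp.ne⟩
    refine ⟨ν, h0, fun p hp => ?_⟩
    rcases hp.lt_or_eq with hp | hp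
    · rw [hagree.toLinearMap_eq p hp, hμ p (by omega)]
    · have h1 := hagree.toLinearMap_sub p (by omega) (by omega)
      rw [show ν.plus ⟨p, _⟩ = _ from if_pos hp, add_sub_cancel_left] at h1
      exact sub_left_injective h1

lemma toCoalgHom_surjective :
    Function.Surjective (toCoalgHom : TransDatum k V W → PathCoalgebra k V →ₗc[k] _) := by
  intro f
  have hex : ∀ i : V, ∃ j : W, f (vertexElem k i) = vertexElem k j := by
    intro i
    refine exists_eq_vertexElem ?_ ?_
    · rw [← CoalgHomClass.map_comp_comul_apply, comul_vertexElem, TensorProduct.map_tmul]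
      rfl
    · rw [CoalgHomClass.counit_comp_apply, counit_vertexElem]
  choose w hw using hex
  choose μ h0 hμ using exists_toLinearMap_eq_below hw
  -- The limit of the approximations: at `p` the datum correct up to the length of `p` is taken.
  -- Later approximations agree with it there by uniqueness.
  let ν : TransDatum k V W :=
    { zero := vertexHom k w
      plus := fun p => (μ p.1.path.length).plus p
      plus_mem := fun p => by
        have := (μ p.1.path.length).plus_mem p
        rwa [h0] at this }
  have hagree : ∀ n, AgreeBelow ν (μ n) (n + 1) := by
    refine fun n => ⟨(h0 n).symm, fun p hp => ?_⟩
    have h1 : AgreeBelow (μ p.1.path.length) (μ n) (p.1.path.length + 1) :=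
      agreeBelow_of_toLinearMap_eq ((h0 _).trans (h0 _).symm) _ fun q hq => by
        rw [hμ _ q (by omega), hμ _ q (by omega)]
    exact h1.2 p (Nat.lt_succ_self _)
  refine ⟨ν, CoalgHom.coe_linearMap_injective (PathCoalgebra.hom_ext fun p => ?_)⟩
  change ν.toLinearMap _ = f _
  rw [(hagree p.path.length).toLinearMap_eq p (Nat.lt_succ_self _), hμ _ p le_rfl]

lemma toCoalgHom_injective :
    Function.Injective (toCoalgHom : TransDatum k V W → PathCoalgebra k V →ₗc[k] _) :=
  fun _ _ h => toLinearMap_injective (congrArg (fun f : _ →ₗc[k] _ => f.toLinearMap) h)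

variable (k V W) in
/-- Trans-data correspond to coalgebra homomorphisms of path coalgebras. -/
noncomputable def equivCoalgHom :
    TransDatum k V W ≃ (PathCoalgebra k V →ₗc[k] PathCoalgebra k W) :=
  Equiv.ofBijective toCoalgHom ⟨toCoalgHom_injective, toCoalgHom_surjective⟩

lemma vertex_one (i : V) : (one k V).vertex i = i :=
  (Finsupp.single_left_injective one_ne_zero ((one k V).zero_single i)).symm

lemma appendArrows_toPath {b c : V} (α : b ⟶ c) {s t : V} (hs : s = b) (ht : t = c) :
    appendArrows s t (PathCoalgebra.ofPath k (mkPath α.toPath)) = appendArrow k α := by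
  subst hs ht
  have : arrowCoeffs s t (PathCoalgebra.ofPath k (mkPath α.toPath)) = Finsupp.single α (1 : k) := by
    classical
    ext β
    change coeffForm k (mkPath β.toPath) _ = _
    rw [coeffForm_ofPath, Finsupp.single_apply]
    simp only [(toPath_injective s t).eq_iff]
  rw [appendArrows, this, Finsupp.linearCombination_single, one_smul]

lemma newCoeff_toPath {b c : V} (α : b ⟶ c) (s t : V) :
    newCoeff s t (PathCoalgebra.ofPath k (mkPath α.toPath)) = 0 := by
  by_cases h : s = t
  · exact newCoeff_of_eq h _
  · rw [newCoeff_of_ne h]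
    refine coeffForm_of_ne fun h => ?_
    simpa using congrArg (fun r : AnyPath V => r.path.length) h

lemma one_appendPiece_arrow {b c : V} (α : b ⟶ c) :
    (one k V).appendPiece ⟨α.toPath, Nat.one_pos⟩ = appendArrow k α :=
  appendArrows_toPath α (vertex_one b) (vertex_one c)

lemma one_appendPiece_of_lt {b c : V} (q : {p : Path b c // 0 < p.length}) (hq : q.1.length ≠ 1) :
    (one k V).appendPiece q = 0 := by
  have : (one k V).plus ⟨mkPath q.1, q.2⟩ = 0 := if_neg hq
  refine LinearMap.ext fun y => ?_
  have h0 : ∀ s t : V, arrowCoeffs s t (0 : PathCoalgebra k V) = 0 :=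
    fun s t => Finsupp.ext fun _ => rfl
  rw [appendPiece, this, appendArrows, h0]
  simp

lemma one_pieceCoeff {b c : V} (q : {p : Path b c // 0 < p.length}) :
    (one k V).pieceCoeff q = 0 := by
  by_cases hq : q.1.length = 1
  · obtain ⟨q, hq0⟩ := q
    have : (one k V).plus ⟨mkPath q, hq0⟩ = PathCoalgebra.ofPath k (mkPath q) := if_pos hq
    rw [pieceCoeff, this]
    cases q with
    | nil => simp at hq0
    | cons q α =>
      cases q with
      | nil => exact newCoeff_toPath α _ _
      | cons q β => simp at hq
  · have : (one k V).plus ⟨mkPath q.1, q.2⟩ = 0 := if_neg hq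
    rw [pieceCoeff, this]
    by_cases h : (one k V).vertex b = (one k V).vertex c
    · exact newCoeff_of_eq h _
    · rw [newCoeff_of_ne h, map_zero]

lemma one_tail_snoc {a b c : V} (d : Decomposition a b) (q : {p : Path b c // 0 < p.length}) :
    (one k V).tail (d.snoc q) = (one k V).appendPiece q ((one k V).tail d) := by
  rw [tail_snoc, one_pieceCoeff, zero_smul, add_zero]

lemma one_value {a b : V} (d : Decomposition a b) : (one k V).value d = (one k V).tail d := by
  induction d using Decomposition.induction with
  | empty => simp
  | snoc d q _ => rw [value_snoc, one_pieceCoeff, zero_smul, add_zero]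

/-- Longer pieces are killed by `𝟙`, so among the extensions of a decomposition by `α` only the one
with `α` as a separate piece survives, and it appends `α`. What remains is the decomposition of `p`
into its arrows. -/
lemma sum_one_tail {a b : V} (p : Path a b) :
    ((decompositions p).map (one k V).tail).sum = PathCoalgebra.ofPath k (mkPath p) := by
  induction p with
  | nil => simp [decompositions_nil, vertex_one]
  | cons p α ih =>
    have h : ∀ d : Decomposition a _, ((d.extensions α).map (one k V).tail).sum =
        appendArrow k α ((one k V).tail d) := by
      intro d
      rw [Decomposition.extensions, List.map_cons, List.sum_cons, one_tail_snoc,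
        one_appendPiece_arrow]
      induction d using Decomposition.induction with
      | empty => simp
      | snoc d q _ =>
        have hq : (q.1.cons α).length ≠ 1 := by
          have := q.2
          rw [Path.length_cons]
          omega
        simp [one_tail_snoc, one_appendPiece_of_lt ⟨q.1.cons α, Nat.succ_pos _⟩ hq]
    rw [sum_decompositions_cons]
    simp only [h]
    rw [← appendArrow_ofPath, ← ih, map_list_sum, List.map_map]
    rfl

lemma equivCoalgHom_one : equivCoalgHom k V V (one k V) = 1 := by
  refine CoalgHom.coe_linearMap_injective (PathCoalgebra.hom_ext fun ⟨a, b, p⟩ => ?_)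
  change (one k V).toLinearMap _ = PathCoalgebra.ofPath k (mkPath p)
  rw [toLinearMap_ofPath, ← sum_one_tail]
  exact congrArg _ (List.map_congr_left fun d _ => one_value d)

end TransDatum

/-! ### Automorphisms as units, and transport of the monoid structure -/

section Units

variable {k : Type w} [Field k] {C : Type*} [AddCommGroup C] [Module k C] [Coalgebra k C]

variable (k C) in
/-- Coalgebra automorphisms are the units of the monoid of coalgebra endomorphisms. -/
noncomputable def coalgAutEquivUnits : (C ≃ₗc[k] C) ≃* (C →ₗc[k] C)ˣ where
  toFun σ := ⟨σ.toCoalgHom, σ.symm.toCoalgHom, CoalgHom.ext σ.apply_symm_apply,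
    CoalgHom.ext σ.symm_apply_apply⟩
  invFun u := CoalgEquiv.ofCoalgHom u.val u.inv u.val_inv u.inv_val
  left_inv _ := rfl
  right_inv _ := Units.ext rfl
  map_mul' _ _ := Units.ext rfl

end Units

/-- Transport of a monoid structure and of its group of units along an equivalence. -/
lemma exists_monoid_of_equiv {M T : Type*} [Monoid M] (e : T ≃ M) :
    ∃ _ : Monoid T, e 1 = 1 ∧ (∀ ν μ : T, e (ν * μ) = e ν * e μ) ∧
      ∃ Φ : Mˣ ≃* Tˣ, ∀ u : Mˣ, e (Φ u).val = u.val := by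
  let _ : Monoid T := e.monoid
  exact ⟨inferInstance, map_one e.mulEquiv, map_mul e.mulEquiv, Units.mapEquiv e.mulEquiv.symm,
    fun u => e.apply_symm_apply u.val⟩

end QuiverCoalgebra

theorem corollary5p2 {k : Type*} [Field k] {V : Type*} [Quiver V] [Finite V]
    [∀ a b : V, Finite (a ⟶ b)] :
    (∀ D : QuiverCoalgebra.Subcoalgebra k (QuiverCoalgebra.PathCoalgebra k V),
      QuiverCoalgebra.IsLarge D →
        ∃ Θ : (D.toSubmodule ≃ₗc[k] D.toSubmodule) ≃*
            (WithConv (D.toSubmodule →ₗ[k] k) ≃ₐ[k] WithConv (D.toSubmodule →ₗ[k] k))ᵐᵒᵖ,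
          ∀ (σ : D.toSubmodule ≃ₗc[k] D.toSubmodule) (f : WithConv (D.toSubmodule →ₗ[k] k))
            (x : D.toSubmodule), (Θ σ).unop f x = f (σ x)) ∧
    (∃ Ψ : (QuiverCoalgebra.PathCoalgebra k V ≃ₗc[k] QuiverCoalgebra.PathCoalgebra k V) ≃*
          (QuiverCoalgebra.CompletePathAlgebra k V ≃ₐ[k] QuiverCoalgebra.CompletePathAlgebra k V),
        ∀ (σ : QuiverCoalgebra.PathCoalgebra k V ≃ₗc[k] QuiverCoalgebra.PathCoalgebra k V)
          (a : QuiverCoalgebra.CompletePathAlgebra k V) (c : QuiverCoalgebra.PathCoalgebra k V),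
          QuiverCoalgebra.pairing k V (Ψ σ a) c = QuiverCoalgebra.pairing k V a (σ⁻¹ c)) ∧
    (∃ _ : Monoid (QuiverCoalgebra.TransDatum k V V),
      (1 : QuiverCoalgebra.TransDatum k V V) = QuiverCoalgebra.TransDatum.one k V ∧
      (∀ ν μ ξ : QuiverCoalgebra.TransDatum k V V,
        ξ = ν * μ ↔ ξ.toLinearMap = ν.toLinearMap ∘ₗ μ.toLinearMap) ∧
      ∃ Φ : (QuiverCoalgebra.PathCoalgebra k V ≃ₗc[k] QuiverCoalgebra.PathCoalgebra k V) ≃*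
          (QuiverCoalgebra.TransDatum k V V)ˣ,
        ∀ (σ : QuiverCoalgebra.PathCoalgebra k V ≃ₗc[k] QuiverCoalgebra.PathCoalgebra k V)
          (x : QuiverCoalgebra.PathCoalgebra k V),
          (Φ σ).val.toLinearMap x = σ x) := by
  refine ⟨fun D hD => ?_, ⟨QuiverCoalgebra.pathAlgebraAutEquiv k V,
    QuiverCoalgebra.pairing_pathAlgebraAutEquiv⟩, ?_⟩
  · have hι : Function.Injective D.subtype := Subtype.val_injective
    have hvert : ∀ i : V, ∃ y, D.subtype y = QuiverCoalgebra.vertexElem k i :=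
      fun i => ⟨⟨_, hD (QuiverCoalgebra.mkPath .nil) (Nat.zero_le _)⟩, rfl⟩
    exact ⟨QuiverCoalgebra.dualAutEquiv hι hvert, QuiverCoalgebra.dualAutEquiv_apply hι hvert⟩
  · obtain ⟨inst, h1, hmul, Φ, hΦ⟩ := QuiverCoalgebra.exists_monoid_of_equiv
      (QuiverCoalgebra.TransDatum.equivCoalgHom k V V)
    refine ⟨inst, ?_, fun ν μ ξ => ?_, (QuiverCoalgebra.coalgAutEquivUnits k _).trans Φ,
      fun σ x => ?_⟩
    · exact (QuiverCoalgebra.TransDatum.equivCoalgHom k V V).injective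
        (h1.trans QuiverCoalgebra.TransDatum.equivCoalgHom_one.symm)
    -- The transported product is composition of the maps `f_μ`, and a coalgebra homomorphism is
    -- determined by its linear map; this gives existence and uniqueness of the composite at once.
    · rw [← (QuiverCoalgebra.TransDatum.equivCoalgHom k V V).injective.eq_iff, hmul]
      exact (CoalgHom.coe_linearMap_injective.eq_iff).symm
    · exact congrArg (fun g : QuiverCoalgebra.PathCoalgebra k V →ₗc[k] _ => g x)
        (hΦ (QuiverCoalgebra.coalgAutEquivUnits k _ σ))
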